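/- Let $R$ be a commutative artinian ring and let $\Lambda$ be an artin $R$-algebra, i.e. an $R$-algebra that is finitely generated as an $R$-module. Assume that $\Lambda$ has finite global dimension. Let $\operatorname{mod}\Lambda$ be the abelian category of finitely generated right $\Lambda$-modules, and let $\mathbb{K}^{b}_{ac}(\operatorname{mod}\Lambda)$ be the full triangulated subcategory of the homotopy category of complexes over $\operatorname{mod}\Lambda$ whose objects are the bounded acyclic complexes. Then $\mathbb{K}^{b}_{ac}(\operatorname{mod}\Lambda)$ is a Hom-finite $R$-linear Krull–Schmidt triangulated category and has Auslander–Reiten triangles. Here an $R$-linear category is Hom-finite if all its Hom spaces are finitely generated $R$-modules, and an additive category is Krull–Schmidt if every object is a finite direct sum of objects with local endomorphism rings. A distinguished triangle $X \xrightarrow{f} Y \xrightarrow{g} Z \xrightarrow{h} X[1]$ in a triangulated category $\mathcal{T}$ is an Auslander–Reiten triangle if (i) $X$ and $Z$ are indecomposable; (ii) $h \neq 0$; (iii) for every indecomposable object $W$ of $\mathcal{T}$, every morphism $W \to Z$ that is not an isomorphism factors through $g$. The category $\mathcal{T}$ has Auslander–Reiten triangles if for every indecomposable object $W$ of $\mathcal{T}$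 there are an Auslander–Reiten triangle with first term $W$ and an Auslander–Reiten triangle with third term $W$. -/

import Mathlib

open CategoryTheory Limits Pretriangulated ZeroObject

universe w v u

/-! ### Bounded homotopy category and its acyclic complexes -/

namespace HomotopyCategory

section Bounded

variable (C : Type u) [Category.{v} C] [Preadditive C]

/-- The property of objects of the homotopy category of cochain complexes in `C` which says
that the underlying complex is bounded: its terms vanish outside of a finite interval. -/
def bounded : ObjectProperty (HomotopyCategory C (ComplexShape.up ℤ)) :=
  fun X => ∃ a b : ℤ, CochainComplex.IsStrictlyGE X.as a ∧ CochainComplex.IsStrictlyLE X.as b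

theorem bounded_quotient_obj_iff (K : CochainComplex C ℤ) :
    bounded C ((quotient _ _).obj K) ↔ ∃ a b : ℤ, K.IsStrictlyGE a ∧ K.IsStrictlyLE b :=
  Iff.rfl

variable [HasBinaryBiproducts C]

theorem bounded_mappingCone {K L : CochainComplex C ℤ} (f : K ⟶ L)
    (hK : bounded C ((quotient _ _).obj K)) (hL : bounded C ((quotient _ _).obj L)) :
    bounded C ((quotient _ _).obj (CochainComplex.mappingCone f)) := by
  obtain ⟨a, b, _, _⟩ := (bounded_quotient_obj_iff C K).1 hK
  obtain ⟨a', b', _, _⟩ := (bounded_quotient_obj_iff C L).1 hL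
  refine (bounded_quotient_obj_iff C _).2 ⟨min (a - 1) a', max b b',
    CochainComplex.isStrictlyGE_mappingCone f a a' _ (by simp) (by simp), ?_⟩
  rw [CochainComplex.isStrictlyLE_iff]
  intro i hi
  simp only [max_lt_iff] at hi
  rw [CochainComplex.mappingCone.isZero_X_iff]
  exact ⟨K.isZero_of_isStrictlyLE b _ (by lia), L.isZero_of_isStrictlyLE b' _ (by lia)⟩

variable [HasZeroObject C]

instance bounded_containsZero : (bounded C).ContainsZero where
  exists_zero := ⟨(quotient C (ComplexShape.up ℤ)).obj (0 : CochainComplex C ℤ),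
    Functor.map_isZero _ (isZero_zero _),
    (bounded_quotient_obj_iff C 0).2 ⟨0, 0, inferInstance, inferInstance⟩⟩

instance bounded_isStableUnderShift : (bounded C).IsStableUnderShift ℤ where
  isStableUnderShiftBy n :=
    { le_shift := by
        intro X hX
        obtain ⟨K : CochainComplex _ _, rfl⟩ := X.quotient_obj_surjective
        obtain ⟨a, b, _, _⟩ := (bounded_quotient_obj_iff C K).1 hX
        rw [ObjectProperty.prop_shift_iff, shift_quotient_obj, bounded_quotient_obj_iff]
        exact ⟨a - n, b - n, K.isStrictlyGE_shift a n (a - n) (by lia),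
          K.isStrictlyLE_shift b n (b - n) (by lia)⟩ }

instance bounded_isTriangulatedClosed₃ : (bounded C).IsTriangulatedClosed₃ where
  ext₃' T hT h₁ h₂ := by
    obtain ⟨f : T.obj₁.as ⟶ T.obj₂.as, hf⟩ := (quotient _ _).map_surjective T.mor₁
    exact ⟨_, bounded_mappingCone C f h₁ h₂,
      ⟨Triangle.π₃.mapIso (isoTriangleOfIso₁₂ T _ hT (mappingCone_triangleh_distinguished f)
        (Iso.refl _) (Iso.refl _)
        ((Category.comp_id _).trans (hf.symm.trans (Category.id_comp _).symm)))⟩⟩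

instance bounded_isTriangulated : (bounded C).IsTriangulated where
  toIsTriangulatedClosed₂ := .of_isTriangulatedClosed₃

end Bounded

section BoundedAcyclic

variable (C : Type u) [Category.{v} C] [Abelian C]

/-- The homotopy category of bounded acyclic complexes in an abelian category `C`, as a full
triangulated subcategory of the homotopy category of all cochain complexes in `C`. -/
abbrev BoundedAcyclic :=
  (bounded C ⊓ subcategoryAcyclic C).FullSubcategory

end BoundedAcyclic

end HomotopyCategory

/-! ### Auslander-Reiten triangles -/

namespace CategoryTheory

/-- An `R`-linear category is Hom-finite if all morphism spaces are finitely generated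
`R`-modules (equivalently, when `R` is artinian: of finite length). -/
def IsHomFinite (R : Type w) [CommRing R] (C : Type u) [Category.{v} C] [Preadditive C]
    [Linear R C] : Prop :=
  ∀ X Y : C, Module.Finite R (X ⟶ Y)

/-- An additive category is Krull-Schmidt if every object is a finite direct sum of objects
with local endomorphism rings. -/
def IsKrullSchmidt (C : Type u) [Category.{v} C] [Preadditive C] [HasFiniteBiproducts C] :
    Prop :=
  ∀ X : C, ∃ (n : ℕ) (F : Fin n → C),
    (∀ i, IsLocalRing (End (F i))) ∧ Nonempty (X ≅ ⨁ F)

section AuslanderReiten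

variable {C : Type u} [Category.{v} C] [Preadditive C] [HasZeroObject C] [HasShift C ℤ]
  [∀ n : ℤ, (shiftFunctor C n).Additive] [Pretriangulated C]

/-- A distinguished triangle `X ⟶ Y ⟶ Z ⟶ X⟦1⟧` is an Auslander-Reiten triangle if `X` and `Z`
are indecomposable, `Z ⟶ X⟦1⟧` is nonzero, and every non-isomorphism from an indecomposable
object to `Z` factors through `Y ⟶ Z`. -/
structure IsAuslanderReitenTriangle (T : Triangle C) : Prop where
  distinguished : T ∈ distTriang C
  indecomposable₁ : Indecomposable T.obj₁
  indecomposable₃ : Indecomposable T.obj₃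
  mor₃_ne_zero : T.mor₃ ≠ 0
  factors : ∀ (W : C), Indecomposable W → ∀ t : W ⟶ T.obj₃, ¬ IsIso t →
    ∃ s : W ⟶ T.obj₂, s ≫ T.mor₂ = t

variable (C) in
/-- `C` has Auslander-Reiten triangles if every indecomposable object is both the starting term
and the end term of Auslander-Reiten triangles. -/
def HasAuslanderReitenTriangles : Prop :=
  ∀ W : C, Indecomposable W →
    (∃ (Y Z : C) (f : W ⟶ Y) (g : Y ⟶ Z) (h : Z ⟶ W⟦(1 : ℤ)⟧),
      IsAuslanderReitenTriangle (Triangle.mk f g h)) ∧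
    (∃ (X Y : C) (f : X ⟶ Y) (g : Y ⟶ W) (h : W ⟶ X⟦(1 : ℤ)⟧),
      IsAuslanderReitenTriangle (Triangle.mk f g h))

end AuslanderReiten

end CategoryTheory

/-! ### Modules over artin algebras -/

/-- A ring `A` has finite global dimension if the projective dimensions of the `A`-modules
are bounded. -/
def HasFiniteGlobalDimension (A : Type u) [Ring A] : Prop :=
  ∃ n : ℕ, ∀ M : ModuleCat.{u} A, HasProjectiveDimensionLE M n

/-- If `A` is an `R`-algebra, the category of `A`-modules is `R`-linear, where `R` acts on
modules through `R → A`. -/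
noncomputable instance ModuleCat.linearOfAlgebra (R : Type w) [CommRing R] (A : Type u) [Ring A]
    [Algebra R A] : Linear R (ModuleCat.{v} A) :=
  letI (M : ModuleCat.{v} A) : Module R M := Module.restrictScalars R A M
  haveI (M : ModuleCat.{v} A) : IsScalarTower R A M := IsScalarTower.restrictScalars R A M
  { homModule := fun _ _ => inferInstance }

/-- The opposite ring of an artin algebra is (left) noetherian. -/
theorem isNoetherianRing_mulOpposite_of_artinAlgebra (R : Type w) [CommRing R]
    [IsArtinianRing R] (A : Type u) [Ring A] [Algebra R A] [Module.Finite R A] :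
    IsNoetherianRing Aᵐᵒᵖ :=
  haveI : Module.Finite R Aᵐᵒᵖ := Module.Finite.equiv (MulOpposite.opLinearEquiv R)
  isNoetherian_of_tower R inferInstance

universe u'

/-! ### Injective hulls and Matlis duality over commutative artinian rings -/

section InjectiveHull

variable {R : Type u} [CommRing R]

theorem Module.exists_injective_embedding (M : Type u) [AddCommGroup M] [Module R M] :
    ∃ (J : Type u) (_ : AddCommGroup J) (_ : Module R J) (i : M →ₗ[R] J),
      Module.Injective R J ∧ Function.Injective i := by
  let X := ModuleCat.of R M
  exact ⟨(Injective.under X : ModuleCat.{u} R), inferInstance, inferInstance, (Injective.ι X).hom,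
    Module.injective_module_of_injective_object R _
      (inj := inferInstanceAs (CategoryTheory.Injective (Injective.under X))),
    (ModuleCat.mono_iff_injective _).1 inferInstance⟩

theorem Module.Injective.of_retract {J : Type u} [AddCommGroup J] [Module R J]
    [hJ : Module.Injective R J] {E : Type u} [AddCommGroup E] [Module R E]
    (i : E →ₗ[R] J) (r : J →ₗ[R] E) (h : ∀ x, r (i x) = x) : Module.Injective R E where
  out _ _ _ _ _ _ f hf g := by
    obtain ⟨k, hk⟩ := hJ.out f hf (i ∘ₗ g)
    exact ⟨r ∘ₗ k, fun x => by simp [hk, h]⟩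

/-- Every module has an injective hull. -/
theorem Module.exists_injective_hull (M : Type u) [AddCommGroup M] [Module R M] :
    ∃ (E : Type u) (_ : AddCommGroup E) (_ : Module R E) (i : M →ₗ[R] E),
      Module.Injective R E ∧ Function.Injective i ∧
        ∀ N : Submodule R E, N ⊓ i.range = ⊥ → N = ⊥ := by
  obtain ⟨J, _, _, i, hJ, hi⟩ := Module.exists_injective_embedding (R := R) M
  obtain ⟨E, hSE, hE⟩ := zorn_le_nonempty₀
    {N : Submodule R J | i.range ≤ N ∧ ∀ K ≤ N, K ⊓ i.range = ⊥ → K = ⊥}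
    (fun c hc hc' N hN => ⟨sSup c, ⟨(hc hN).1.trans (le_sSup hN), fun K hK hKi => by
        refine (Submodule.eq_bot_iff _).2 fun x hx => ?_
        obtain ⟨N', hN', hx'⟩ := (Submodule.mem_sSup_of_directed ⟨N, hN⟩
          hc'.directedOn).1 (hK hx)
        have := (hc hN').2 (Submodule.span R {x}) (by simpa using hx') (by
          rw [eq_bot_iff, ← hKi]
          exact inf_le_inf_right _ (by simpa using hx))
        simpa using this⟩, fun N hN => le_sSup hN⟩) i.range
    ⟨le_rfl, fun K hK h => by rwa [inf_eq_left.2 hK] at h⟩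
  obtain ⟨C, -, hC⟩ := zorn_le_nonempty₀ {N : Submodule R J | N ⊓ E = ⊥}
    (fun c hc hc' N hN => ⟨sSup c, by
        refine (Submodule.eq_bot_iff _).2 fun x hx => ?_
        obtain ⟨N', hN', hx'⟩ := (Submodule.mem_sSup_of_directed ⟨N, hN⟩
          hc'.directedOn).1 hx.1
        exact (Submodule.eq_bot_iff _).1 (hc hN') x ⟨hx', hx.2⟩,
      fun N hN => le_sSup hN⟩) ⊥ (by simp)
  have hCE : C ⊓ E = ⊥ := hC.prop
  have hess : ∀ K : Submodule R (J ⧸ C), K ⊓ E.map C.mkQ = ⊥ → K = ⊥ := fun K hK => by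
    have h1 : C ≤ K.comap C.mkQ := fun x hx => by
      simp [(Submodule.Quotient.mk_eq_zero C).2 hx]
    have h2 : K.comap C.mkQ ⊓ E = ⊥ := by
      refine (Submodule.eq_bot_iff _).2 fun x hx => ?_
      have h3 : C.mkQ x ∈ K ⊓ E.map C.mkQ := ⟨hx.1, x, hx.2, rfl⟩
      rw [hK, Submodule.mem_bot, Submodule.mkQ_apply, Submodule.Quotient.mk_eq_zero] at h3
      exact (Submodule.eq_bot_iff _).1 hCE x ⟨h3, hx.2⟩
    have h3 := hC.le_of_ge h2 h1
    refine (Submodule.eq_bot_iff _).2 fun y hy => ?_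
    obtain ⟨x, rfl⟩ := C.mkQ_surjective y
    exact (Submodule.Quotient.mk_eq_zero C).2 (h3 hy)
  have hinj : Function.Injective (C.mkQ ∘ₗ E.subtype) := by
    refine (injective_iff_map_eq_zero _).2 fun x hx => ?_
    exact Subtype.ext ((Submodule.eq_bot_iff _).1 hCE x
      ⟨(Submodule.Quotient.mk_eq_zero C).1 hx, x.2⟩)
  obtain ⟨g, hg⟩ := hJ.out (C.mkQ ∘ₗ E.subtype) hinj E.subtype
  replace hg : ∀ x ∈ E, g (C.mkQ x) = x := fun x hx => hg ⟨x, hx⟩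
  have hgi : g.ker = ⊥ := hess _ ((Submodule.eq_bot_iff _).2 (by
    rintro _ ⟨h1, x, hx, rfl⟩
    have : x = 0 := by rw [← hg x hx]; exact h1
    simp [this]))
  have hEg : E ≤ g.range := fun x hx => ⟨_, hg x hx⟩
  have hgE : g.range ≤ E := hE.le_of_ge ⟨hSE.trans hEg, fun K hK hKi => by
    have h1 : K ⊓ E = ⊥ := hE.prop.2 _ inf_le_right (by
      rw [eq_bot_iff, ← hKi]
      exact inf_le_inf_right _ inf_le_left)
    have h2 : K.comap g = ⊥ := hess _ ((Submodule.eq_bot_iff _).2 (by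
      rintro _ ⟨h2, x, hx, rfl⟩
      have : x ∈ K ⊓ E := ⟨by rw [← hg x hx]; exact h2, hx⟩
      rw [h1, Submodule.mem_bot] at this
      simp [this]))
    refine (Submodule.eq_bot_iff _).2 fun x hx => ?_
    obtain ⟨y, rfl⟩ := hK hx
    have : y ∈ K.comap g := hx
    rw [h2, Submodule.mem_bot] at this
    simp [this]⟩ hEg
  refine ⟨E, inferInstance, inferInstance, i.codRestrict E fun x => hSE ⟨x, rfl⟩, ?_, ?_, ?_⟩
  · exact Module.Injective.of_retract E.subtype
      ((g ∘ₗ C.mkQ).codRestrict E fun x => hgE ⟨_, rfl⟩) fun x => Subtype.ext (hg x x.2)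
  · exact fun x y h => hi (congrArg Subtype.val h)
  · intro N hN
    have := hE.prop.2 (N.map E.subtype) (by rintro _ ⟨x, -, rfl⟩; exact x.2)
      ((Submodule.eq_bot_iff _).2 (by
        rintro _ ⟨⟨x, hx, rfl⟩, y, hy⟩
        have : x ∈ N ⊓ (i.codRestrict E fun x => hSE ⟨x, rfl⟩).range :=
          ⟨hx, y, Subtype.ext hy⟩
        rw [hN, Submodule.mem_bot] at this
        simp [this]))
    exact Submodule.map_injective_of_injective E.injective_subtype (by simpa using this)

end InjectiveHull

section Matlis

variable {R : Type u} [CommRing R]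

/-- A module `E` such that `Hom(-, E)` is a duality of the category of finitely generated
modules. -/
structure IsMatlisModule (R : Type u) [CommRing R] (E : Type u) [AddCommGroup E] [Module R E] :
    Prop where
  injective : Module.Injective R E
  finite : Module.Finite R E
  exists_ne_zero : ∀ (M : Type u) [AddCommGroup M] [Module R M] (x : M), x ≠ 0 →
    ∃ f : M →ₗ[R] E, f x ≠ 0
  exists_eq_eval : ∀ (M : Type u) [AddCommGroup M] [Module R M] [Module.Finite R M]
    (ψ : (M →ₗ[R] E) →ₗ[R] E), ∃ x, ∀ f, ψ f = f x

theorem Module.Injective.exists_map_ne_zero {E : Type u} [AddCommGroup E] [Module R E]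
    [hE : Module.Injective R E]
    (h : ∀ m : Ideal R, m.IsMaximal → ∃ g : (R ⧸ m) →ₗ[R] E, g 1 ≠ 0)
    (M : Type u) [AddCommGroup M] [Module R M] (x : M) (hx : x ≠ 0) :
    ∃ f : M →ₗ[R] E, f x ≠ 0 := by
  let p := LinearMap.toSpanSingleton R M x
  obtain ⟨m, hm, hpm⟩ := Ideal.exists_le_maximal p.ker (fun h => hx (by
    have : (1 : R) ∈ p.ker := h ▸ Submodule.mem_top
    simpa [p] using this))
  obtain ⟨g, hg⟩ := h m hm
  obtain ⟨f, hf⟩ := hE.out (p.ker.liftQ p le_rfl)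
    (LinearMap.ker_eq_bot.1 (Submodule.ker_liftQ_eq_bot _ _ _ le_rfl))
    (p.ker.liftQ (g ∘ₗ m.mkQ) (fun r hr => by
      have h1 := (Submodule.Quotient.mk_eq_zero m).2 (hpm hr)
      change g (Submodule.Quotient.mk r) = 0
      rw [h1, map_zero]))
  refine ⟨f, ?_⟩
  have := hf (Submodule.Quotient.mk 1)
  simp only [Submodule.liftQ_apply] at this
  have hx : f x = f (p 1) := by simp [p]
  rw [hx, this]
  exact hg

theorem length_linearMap_le_one_of_isSimpleModule {E : Type u} [AddCommGroup E] [Module R E]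
    (h : ∀ (m : Ideal R), m.IsMaximal → ∀ a b : E, a ≠ 0 → (∀ r ∈ m, r • a = 0) →
      (∀ r ∈ m, r • b = 0) → ∃ r : R, b = r • a)
    (M : Type u) [AddCommGroup M] [Module R M] [IsSimpleModule R M] :
    Module.length R (M →ₗ[R] E) ≤ 1 := by
  obtain hs | hs := subsingleton_or_nontrivial (M →ₗ[R] E)
  · simp [Module.length_eq_zero]
  · have : IsSimpleModule R (M →ₗ[R] E) := by
      refine isSimpleModule_iff_toSpanSingleton_surjective.2 ⟨hs, fun f hf g => ?_⟩
      have := IsSimpleModule.nontrivial R M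
      obtain ⟨s, hs⟩ := exists_ne (0 : M)
      have hsurj := IsSimpleModule.toSpanSingleton_surjective R hs
      obtain ⟨r, hr⟩ := h _ (IsSimpleModule.ker_toSpanSingleton_isMaximal R hs) (f s) (g s)
        (fun h0 => hf (by
          ext x
          obtain ⟨r, rfl⟩ := hsurj x
          simp [h0]))
        (fun r hr => by
          rw [← map_smul, show r • s = 0 by simpa using hr, map_zero])
        (fun r hr => by
          rw [← map_smul, show r • s = 0 by simpa using hr, map_zero])
      refine ⟨r, ?_⟩
      ext x
      obtain ⟨t, rfl⟩ := hsurj x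
      simp [hr]
    rw [Module.length_eq_one]

theorem length_linearMap_le_of_isFiniteLength {E : Type u} [AddCommGroup E] [Module R E]
    (h : ∀ (M : Type u) [AddCommGroup M] [Module R M] [IsSimpleModule R M],
      Module.length R (M →ₗ[R] E) ≤ 1)
    (M : Type u) [AddCommGroup M] [Module R M] (hM : IsFiniteLength R M) :
    Module.length R (M →ₗ[R] E) ≤ Module.length R M := by
  induction hM with
  | of_subsingleton => simp [Module.length_eq_zero]
  | of_simple_quotient hN ih =>
    rename_i M _ _ N _
    let f : ((M ⧸ N) →ₗ[R] E) →ₗ[R] (M →ₗ[R] E) := LinearMap.lcomp R E N.mkQ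
    let g : (M →ₗ[R] E) →ₗ[R] (N →ₗ[R] E) := LinearMap.lcomp R E N.subtype
    have hf : Function.Injective f := fun a b hab => by
      ext x
      exact LinearMap.congr_fun hab x
    have hfg : Function.Exact f g.rangeRestrict := by
      intro φ
      constructor
      · intro hφ
        refine ⟨N.liftQ φ fun x hx => ?_, ?_⟩
        · exact LinearMap.congr_fun (congrArg Subtype.val hφ) ⟨x, hx⟩
        · ext x
          rfl
      · rintro ⟨φ, rfl⟩
        refine Subtype.ext ?_
        ext x
        simp [f, g, (Submodule.Quotient.mk_eq_zero N).2 x.2]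
    rw [Module.length_eq_add_of_exact f g.rangeRestrict hf g.surjective_rangeRestrict hfg,
      Module.length_eq_add_of_exact N.subtype N.mkQ N.injective_subtype N.mkQ_surjective
        (LinearMap.exact_subtype_mkQ N), add_comm]
    refine add_le_add ((Module.length_le_of_injective _ g.range.injective_subtype).trans ih) ?_
    rw [Module.length_eq_one R (M ⧸ N)]
    exact h _

theorem exists_isMatlisModule (R : Type u) [CommRing R] [IsArtinianRing R] :
    ∃ (E : Type u) (_ : AddCommGroup E) (_ : Module R E), IsMatlisModule R E := by
  classical
  obtain ⟨E, _, _, i, hE, hi, hess⟩ := Module.exists_injective_hull (R := R)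
    (∀ m : MaximalSpectrum R, R ⧸ m.asIdeal)
  have hsep := hE.exists_map_ne_zero (fun m hm =>
    ⟨i ∘ₗ LinearMap.single R (fun m : MaximalSpectrum R => R ⧸ m.asIdeal) ⟨m, hm⟩, fun h0 => by
      have h1 := congrFun (hi (h0.trans i.map_zero.symm)) ⟨m, hm⟩
      simp only [LinearMap.coe_single, Pi.single_eq_same, Pi.zero_apply] at h1
      have : Nontrivial (R ⧸ m) := Ideal.Quotient.nontrivial_iff.2 hm.ne_top
      exact one_ne_zero h1⟩)
  have hsoc : ∀ (m : Ideal R) (hm : m.IsMaximal) (a : E), (∀ r ∈ m, r • a = 0) →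
      ∃ c : R ⧸ m, a = i (Pi.single (M := fun m : MaximalSpectrum R => R ⧸ m.asIdeal)
        ⟨m, hm⟩ c) := by
    intro m hm a ha
    by_cases ha0 : a = 0
    · exact ⟨0, by simp [ha0]⟩
    have h1 : R ∙ a ⊓ i.range ≠ ⊥ := fun h => ha0 (by simpa using hess _ h)
    obtain ⟨x, ⟨hx1, y, hy⟩, hx0⟩ := Submodule.exists_mem_ne_zero_of_ne_bot h1
    obtain ⟨r, rfl⟩ := Submodule.mem_span_singleton.1 hx1
    have hrm : r ∉ m := fun h => hx0 (ha r h)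
    obtain ⟨t, ht⟩ := hm.exists_inv hrm
    obtain ⟨s, hs, hts⟩ := ht
    have haty : a = i (t • y) := by
      rw [map_smul, hy, smul_smul]
      calc a = (t * r + s) • a := by rw [hts, one_smul]
        _ = _ := by rw [add_smul, ha s hs, add_zero]
    refine ⟨(t • y) ⟨m, hm⟩, haty.trans (congrArg i ?_)⟩
    ext m'
    by_cases hmm : m' = ⟨m, hm⟩
    · subst hmm
      simp
    · rw [Pi.single_eq_of_ne hmm]
      have hne : ¬ m ≤ m'.asIdeal := fun h => hmm
        (MaximalSpectrum.ext (hm.eq_of_le m'.isMaximal.ne_top h).symm)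
      obtain ⟨s, hs, hs'⟩ := Set.not_subset.1 hne
      have h2 : s • (t • y) = 0 := hi (by rw [map_smul, ← haty, ha s hs, map_zero])
      have h3 : s • (t • y) m' = 0 := congrFun h2 m'
      obtain ⟨t', s', hs1, hs2⟩ := m'.isMaximal.exists_inv hs'
      have h4 : ∀ z : R ⧸ m'.asIdeal, s' • z = 0 := fun z => by
        obtain ⟨z, rfl⟩ := Ideal.Quotient.mk_surjective z
        exact Ideal.Quotient.eq_zero_iff_mem.2 (m'.asIdeal.mul_mem_right _ hs1)
      calc (t • y) m' = (t' * s + s') • (t • y) m' := by rw [hs2, one_smul]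
        _ = 0 := by rw [add_smul, h4, add_zero, mul_smul, h3, smul_zero]
  have hlen1 := length_linearMap_le_one_of_isSimpleModule (R := R) (E := E)
    (fun m hm a b ha0 ha hb => by
      obtain ⟨c, rfl⟩ := hsoc m hm a ha
      obtain ⟨d, rfl⟩ := hsoc m hm b hb
      let := Ideal.Quotient.field m
      have hc : c ≠ 0 := fun h => ha0 (by simp [h])
      obtain ⟨r, hr⟩ := Ideal.Quotient.mk_surjective (d * c⁻¹)
      refine ⟨r, ?_⟩
      rw [← map_smul, ← Pi.single_smul]
      congr 2
      have : r • c = Ideal.Quotient.mk m r * c := by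
        rw [Algebra.smul_def]; rfl
      rw [this, hr, inv_mul_cancel_right₀ hc])
  have hlen := length_linearMap_le_of_isFiniteLength (R := R) (E := E) hlen1
  have hfl : ∀ (M : Type u) [AddCommGroup M] [Module R M], IsFiniteLength R M →
      IsFiniteLength R (M →ₗ[R] E) := fun M _ _ hM => by
    rw [← Module.length_ne_top_iff] at hM ⊢
    exact ne_top_of_le_ne_top hM (hlen M (Module.length_ne_top_iff.1 hM))
  have hfin : ∀ (M : Type u) [AddCommGroup M] [Module R M] [Module.Finite R M],
      IsFiniteLength R M := fun M _ _ _ =>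
    isFiniteLength_iff_isNoetherian_isArtinian.2 ⟨inferInstance, inferInstance⟩
  refine ⟨E, inferInstance, inferInstance, hE, ?_, hsep, fun M _ _ _ ψ => ?_⟩
  · have := (isFiniteLength_iff_isNoetherian_isArtinian.1
      (hfl R (hfin R))).1
    exact Module.Finite.equiv (LinearMap.ringLmapEquivSelf R R E)
  · let ev : M →ₗ[R] ((M →ₗ[R] E) →ₗ[R] E) := LinearMap.flip LinearMap.id
    have hev : Function.Injective ev := (injective_iff_map_eq_zero _).2 fun x hx => by
      by_contra h
      obtain ⟨f, hf⟩ := hsep M x h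
      exact hf (LinearMap.congr_fun hx f)
    have hD := hfl M (hfin M)
    obtain ⟨h1, h2⟩ := isFiniteLength_iff_isNoetherian_isArtinian.1 (hfl _ hD)
    have htop : ev.range = ⊤ := by
      by_contra h
      refine absurd (Submodule.length_lt h) (not_lt.2 ?_)
      rw [← (LinearEquiv.ofInjective ev hev).length_eq]
      exact (hlen _ hD).trans (hlen M (hfin M))
    obtain ⟨x, hx⟩ := LinearMap.range_eq_top.1 htop ψ
    exact ⟨x, fun f => by rw [← hx]; rfl⟩

end Matlis

/-! ### Nakayama pairs -/

namespace CategoryTheory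

section

variable {R : Type w} [CommRing R] {E : Type v} [AddCommGroup E] [Module R E]
variable {C : Type u} [Category.{v} C] [Preadditive C] [Linear R C]

/-- A linear form `φ` on `P ⟶ I` such that the composition `(P ⟶ U) × (U ⟶ I) → (P ⟶ I)`
followed by `φ` is a perfect `E`-valued pairing for all `U`. -/
structure IsNakayamaPair {P I : C} (φ : (P ⟶ I) →ₗ[R] E) : Prop where
  exists_right : ∀ {U : C} (ψ : (P ⟶ U) →ₗ[R] E), ∃ g : U ⟶ I, ∀ f, ψ f = φ (f ≫ g)
  exists_left : ∀ {U : C} (ψ : (U ⟶ I) →ₗ[R] E), ∃ f : P ⟶ U, ∀ g, ψ g = φ (f ≫ g)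
  right_eq_zero : ∀ {U : C} (g : U ⟶ I), (∀ f : P ⟶ U, φ (f ≫ g) = 0) → g = 0
  left_eq_zero : ∀ {U : C} (f : P ⟶ U), (∀ g : U ⟶ I, φ (f ≫ g) = 0) → f = 0

namespace IsNakayamaPair

variable {D : Type u'} [Category.{v} D] [Preadditive D] [Linear R D]
variable {ι : Type*} [Fintype ι] (ev : ι → D ⥤ C) [∀ i, (ev i).Additive] [∀ i, (ev i).Linear R]
  {Q J : ι → C} {P I : D} (a : ∀ i, Q i ⟶ (ev i).obj P) (b : ∀ i, (ev i).obj I ⟶ J i)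

/-- The linear map which sends `f : P ⟶ I` to `a i ≫ (ev i).map f ≫ b i`. -/
@[simps]
def sandwich (R : Type w) [CommRing R] [Linear R C] [Linear R D] [∀ i, (ev i).Linear R] (i : ι) :
    (P ⟶ I) →ₗ[R] (Q i ⟶ J i) where
  toFun f := a i ≫ (ev i).map f ≫ b i
  map_add' := by simp
  map_smul' := by simp

/-- The linear form on `P ⟶ I` induced by a family of linear forms. -/
def familyForm (φ : ∀ i, (Q i ⟶ J i) →ₗ[R] E) : (P ⟶ I) →ₗ[R] E :=
  ∑ i, φ i ∘ₗ sandwich ev a b R i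

lemma familyForm_apply (φ : ∀ i, (Q i ⟶ J i) →ₗ[R] E) (f : P ⟶ I) :
    familyForm ev a b φ f = ∑ i, φ i (a i ≫ (ev i).map f ≫ b i) := by
  simp [familyForm]

theorem of_family (φ : ∀ i, (Q i ⟶ J i) →ₗ[R] E) (hφ : ∀ i, IsNakayamaPair (φ i))
    (ha : ∀ (U : D) (f : ∀ i, Q i ⟶ (ev i).obj U),
      ∃! g : P ⟶ U, ∀ i, a i ≫ (ev i).map g = f i)
    (hb : ∀ (U : D) (f : ∀ i, (ev i).obj U ⟶ J i),
      ∃! g : U ⟶ I, ∀ i, (ev i).map g ≫ b i = f i) :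
    IsNakayamaPair (familyForm ev a b φ) := by
  classical
  let La (U : D) : (P ⟶ U) ≃ₗ[R] (∀ i, Q i ⟶ (ev i).obj U) :=
    LinearEquiv.ofBijective
      { toFun := fun g i => a i ≫ (ev i).map g
        map_add' := fun _ _ => by ext; simp
        map_smul' := fun _ _ => by ext; simp }
      (by
        rw [Function.bijective_iff_existsUnique]
        intro f
        obtain ⟨g, hg, hg'⟩ := ha U f
        exact ⟨g, funext hg, fun g' h => hg' g' (congrFun h)⟩)
  let Lb (U : D) : (U ⟶ I) ≃ₗ[R] (∀ i, (ev i).obj U ⟶ J i) :=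
    LinearEquiv.ofBijective
      { toFun := fun g i => (ev i).map g ≫ b i
        map_add' := fun _ _ => by ext; simp
        map_smul' := fun _ _ => by ext; simp }
      (by
        rw [Function.bijective_iff_existsUnique]
        intro f
        obtain ⟨g, hg, hg'⟩ := hb U f
        exact ⟨g, funext hg, fun g' h => hg' g' (congrFun h)⟩)
  have hLa : ∀ {U} (g : P ⟶ U) i, a i ≫ (ev i).map g = La U g i := fun _ _ => rfl
  have hLb : ∀ {U} (g : U ⟶ I) i, (ev i).map g ≫ b i = Lb U g i := fun _ _ => rfl
  have key : ∀ {U} (f : P ⟶ U) (g : U ⟶ I), familyForm ev a b φ (f ≫ g) =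
      ∑ i, φ i (La U f i ≫ Lb U g i) := fun f g => by
    rw [familyForm_apply]
    refine Finset.sum_congr rfl fun i _ => ?_
    rw [← hLa, ← hLb]
    simp
  have keya : ∀ {U} (i : ι) (f : Q i ⟶ (ev i).obj U) (g : U ⟶ I),
      familyForm ev a b φ ((La U).symm (Pi.single i f) ≫ g) = φ i (f ≫ Lb U g i) := by
    intro U i f g
    rw [key, LinearEquiv.apply_symm_apply, Finset.sum_eq_single i, Pi.single_eq_same]
    · intro j _ hj
      rw [Pi.single_eq_of_ne hj, zero_comp, map_zero]
    · simp
  have keyb : ∀ {U} (i : ι) (f : P ⟶ U) (g : (ev i).obj U ⟶ J i),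
      familyForm ev a b φ (f ≫ (Lb U).symm (Pi.single i g)) = φ i (La U f i ≫ g) := by
    intro U i f g
    rw [key, LinearEquiv.apply_symm_apply, Finset.sum_eq_single i, Pi.single_eq_same]
    · intro j _ hj
      rw [Pi.single_eq_of_ne hj, comp_zero, map_zero]
    · simp
  constructor
  · intro U ψ
    choose g hg using fun i => (hφ i).exists_right
      (ψ ∘ₗ (La U).symm.toLinearMap ∘ₗ LinearMap.single R (fun i => Q i ⟶ (ev i).obj U) i)
    refine ⟨(Lb U).symm g, fun f => ?_⟩
    rw [key, LinearEquiv.apply_symm_apply]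
    simp only [← hg]
    conv_lhs => rw [← (La U).symm_apply_apply f, ← Finset.univ_sum_single (La U f)]
    simp
  · intro U ψ
    choose f hf using fun i => (hφ i).exists_left
      (ψ ∘ₗ (Lb U).symm.toLinearMap ∘ₗ LinearMap.single R (fun i => (ev i).obj U ⟶ J i) i)
    refine ⟨(La U).symm f, fun g => ?_⟩
    rw [key, LinearEquiv.apply_symm_apply]
    simp only [← hf]
    conv_lhs => rw [← (Lb U).symm_apply_apply g, ← Finset.univ_sum_single (Lb U g)]
    simp
  · intro U g hg
    rw [← (Lb U).map_eq_zero_iff]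
    ext i
    exact (hφ i).right_eq_zero _ fun f => by rw [← keya, hg]
  · intro U f hf
    rw [← (La U).map_eq_zero_iff]
    ext i
    exact (hφ i).left_eq_zero _ fun g => by rw [← keyb, hf]

end IsNakayamaPair

theorem IsNakayamaPair.exists_biproduct [HasFiniteBiproducts C] {n : ℕ} {Q J : Fin n → C}
    (φ : ∀ i, (Q i ⟶ J i) →ₗ[R] E) (hφ : ∀ i, IsNakayamaPair (φ i)) :
    ∃ φ : ((⨁ Q) ⟶ (⨁ J)) →ₗ[R] E, IsNakayamaPair φ :=
  ⟨_, IsNakayamaPair.of_family (fun _ => 𝟭 C) (biproduct.ι Q) (biproduct.π J) φ hφ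
    (fun U f => ⟨biproduct.desc f, by simp, fun g hg => by ext i; simpa using hg i⟩)
    (fun U f => ⟨biproduct.lift f, by simp, fun g hg => by ext i; simpa using hg i⟩)⟩

end

end CategoryTheory

section

open CategoryTheory

variable {R : Type u} [CommRing R] {E : Type v} [AddCommGroup E] [Module R E]

theorem IsMatlisModule.exists_extension {E : Type u} [AddCommGroup E] [Module R E]
    (hE : IsMatlisModule R E) {M N : Type u} [AddCommGroup M] [Module R M]
    [AddCommGroup N] [Module R N] (i : M →ₗ[R] N) (hi : Function.Injective i) (f : M →ₗ[R] E) :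
    ∃ g : N →ₗ[R] E, ∀ x, g (i x) = f x :=
  hE.injective.out i hi f

theorem IsMatlisModule.exists_factor {E : Type u} [AddCommGroup E] [Module R E]
    (hE : IsMatlisModule R E) {M N : Type u} [AddCommGroup M] [Module R M]
    [AddCommGroup N] [Module R N] (i : M →ₗ[R] N) (f : M →ₗ[R] E) (hf : ∀ x, i x = 0 → f x = 0) :
    ∃ g : N →ₗ[R] E, ∀ x, g (i x) = f x := by
  obtain ⟨g, hg⟩ := hE.exists_extension (i.ker.liftQ i le_rfl)
    (LinearMap.ker_eq_bot.1 (Submodule.ker_liftQ_eq_bot _ _ _ le_rfl))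
    (i.ker.liftQ f hf)
  exact ⟨g, fun x => hg (Submodule.Quotient.mk x)⟩

end

namespace CategoryTheory.IsNakayamaPair

variable {R : Type v} [CommRing R] {E : Type v} [AddCommGroup E] [Module R E]
variable {C : Type u} [Category.{v} C] [Abelian C] [Linear R C] {P I : C} {φ : (P ⟶ I) →ₗ[R] E}

theorem injective (hφ : IsNakayamaPair φ) (hE : IsMatlisModule R E) : Injective I where
  factors {X Y} g f hf := by
    obtain ⟨ψ, hψ⟩ := hE.exists_extension (Linear.rightComp R P f)
      (fun a b h => (cancel_mono f).1 h) (φ ∘ₗ Linear.rightComp R P g)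
    obtain ⟨g', hg'⟩ := hφ.exists_right ψ
    refine ⟨g', sub_eq_zero.1 (hφ.right_eq_zero _ fun a => ?_)⟩
    have h1 := hψ a
    simp only [Linear.rightComp_apply, LinearMap.comp_apply, hg'] at h1
    rw [Preadditive.comp_sub, map_sub, sub_eq_zero, ← h1, Category.assoc]

theorem projective (hφ : IsNakayamaPair φ) (hE : IsMatlisModule R E) : Projective P where
  factors {X Y} g f hf := by
    obtain ⟨ψ, hψ⟩ := hE.exists_extension (Linear.leftComp R I f)
      (fun a b h => (cancel_epi f).1 h) (φ ∘ₗ Linear.leftComp R I g)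
    obtain ⟨g', hg'⟩ := hφ.exists_left ψ
    refine ⟨g', sub_eq_zero.1 (hφ.left_eq_zero _ fun a => ?_)⟩
    have h1 := hψ a
    simp only [Linear.leftComp_apply, LinearMap.comp_apply, hg'] at h1
    rw [Preadditive.sub_comp, map_sub, sub_eq_zero, ← h1, Category.assoc]

end CategoryTheory.IsNakayamaPair

/-! ### Nakayama pairs over artin algebras -/

/-- The dual `Hom_R(A, E)` of the right regular module, as a left `A`-module. -/
def RegularDual (R : Type u) [CommRing R] (A : Type u) [Ring A] [Algebra R A] (E : Type u)
    [AddCommGroup E] [Module R E] : Type u := A →ₗ[R] E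

namespace RegularDual

variable (R : Type u) [CommRing R] (A : Type u) [Ring A] [Algebra R A] (E : Type u)
    [AddCommGroup E] [Module R E]

instance : AddCommGroup (RegularDual R A E) := inferInstanceAs (AddCommGroup (A →ₗ[R] E))

instance : Module R (RegularDual R A E) := inferInstanceAs (Module R (A →ₗ[R] E))

instance : FunLike (RegularDual R A E) A E := inferInstanceAs (FunLike (A →ₗ[R] E) A E)

instance : LinearMapClass (RegularDual R A E) R A E :=
  inferInstanceAs (LinearMapClass (A →ₗ[R] E) R A E)

variable {R A E}

@[ext]
theorem ext {f g : RegularDual R A E} (h : ∀ x, f x = g x) : f = g := LinearMap.ext h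

instance : SMul A (RegularDual R A E) where
  smul a f := LinearMap.comp (show A →ₗ[R] E from f) (LinearMap.mulRight R a)

theorem smul_apply (a : A) (f : RegularDual R A E) (x : A) : (a • f) x = f (x * a) := rfl

theorem add_apply (f g : RegularDual R A E) (x : A) : (f + g) x = f x + g x := rfl

theorem zero_apply (x : A) : (0 : RegularDual R A E) x = 0 := rfl

theorem smul_apply' (r : R) (f : RegularDual R A E) (x : A) : (r • f) x = r • f x := rfl

instance : Module A (RegularDual R A E) where
  one_smul f := by ext; simp [smul_apply]
  mul_smul a b f := by ext; simp [smul_apply, mul_assoc]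
  smul_zero a := by ext; simp [smul_apply, zero_apply]
  smul_add a f g := by ext; simp [smul_apply, add_apply]
  add_smul a b f := by ext; simp [smul_apply, add_apply, mul_add]
  zero_smul f := by ext; simp [smul_apply, zero_apply]

theorem algebraMap_smul (r : R) (f : RegularDual R A E) : algebraMap R A r • f = r • f := by
  ext x
  rw [smul_apply, smul_apply', ← Algebra.commutes, ← Algebra.smul_def, map_smul]

instance : IsScalarTower R A (RegularDual R A E) :=
  IsScalarTower.of_algebraMap_smul algebraMap_smul

end RegularDual

theorem Module.Finite.linearMap_of_isNoetherian {R : Type*} [CommRing R] [IsNoetherianRing R]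
    {A : Type*} [Ring A] [Algebra R A] (M N : Type*) [AddCommGroup M] [Module R M]
    [Module A M] [IsScalarTower R A M] [AddCommGroup N] [Module R N] [Module A N]
    [IsScalarTower R A N] [Module.Finite A M] [Module.Finite R N] :
    Module.Finite R (M →ₗ[A] N) := by
  obtain ⟨n, s, hs⟩ := Module.Finite.exists_fin (R := A) (M := M)
  let f : (M →ₗ[A] N) →ₗ[R] (Fin n → N) :=
    { toFun := fun g i => g (s i)
      map_add' := fun _ _ => rfl
      map_smul' := fun _ _ => rfl }
  exact Module.Finite.of_injective f fun g h hgh =>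
    LinearMap.ext_on_range hs (congrFun hgh)

instance RegularDual.finite (R : Type u) [CommRing R] [IsNoetherianRing R] (A : Type u) [Ring A]
    [Algebra R A] [Module.Finite R A] (E : Type u) [AddCommGroup E] [Module R E]
    [Module.Finite R E] : Module.Finite A (RegularDual R A E) :=
  haveI : Module.Finite R (RegularDual R A E) := Module.Finite.linearMap_of_isNoetherian A E
  Module.Finite.of_restrictScalars_finite R A _

namespace FGModuleCat

section

variable {R : Type w} [CommRing R] {A : Type u} [Ring A] [Algebra R A]

theorem finite_hom [IsNoetherianRing R] [Module.Finite R A] (M N : FGModuleCat.{v} A) :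
    Module.Finite R (M ⟶ N) := by
  let : Module R M := Module.compHom M (algebraMap R A)
  let : Module R N := Module.compHom N (algebraMap R A)
  have : IsScalarTower R A M := IsScalarTower.of_algebraMap_smul fun _ _ => rfl
  have : IsScalarTower R A N := IsScalarTower.of_algebraMap_smul fun _ _ => rfl
  have : Module.Finite R N := Module.Finite.trans A N
  have := Module.Finite.linearMap_of_isNoetherian (R := R) (A := A) M N
  exact Module.Finite.of_injective
    ({ toFun := fun f => f.hom.hom, map_add' := fun _ _ => rfl, map_smul' := fun _ _ => rfl } :
      (M ⟶ N) →ₗ[R] (M →ₗ[A] N)) fun f g h => FGModuleCat.hom_ext h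

end

variable {R : Type u} [CommRing R] [IsArtinianRing R] {A : Type u} [Ring A] [Algebra R A]
  [Module.Finite R A] {E : Type u} [AddCommGroup E] [Module R E]

/-- The morphism from the regular module that corresponds to an element. -/
def elementHom (M : FGModuleCat.{u} A) (x : M) : FGModuleCat.of A A ⟶ M :=
  ObjectProperty.homMk (ModuleCat.ofHom (LinearMap.toSpanSingleton A M x))

theorem elementHom_hom_one {M : FGModuleCat.{u} A} (f : FGModuleCat.of A A ⟶ M) :
    elementHom M (f.hom.hom (1 : A)) = f := by
  apply hom_ext
  ext
  exact one_smul A _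

theorem exists_isNakayamaPair_regular (hE : IsMatlisModule R E) :
    haveI := hE.finite
    ∃ φ : (FGModuleCat.of A A ⟶ FGModuleCat.of A (RegularDual R A E)) →ₗ[R] E,
      IsNakayamaPair φ ∧ ∀ (U : FGModuleCat.{u} A) (u : U), u ≠ 0 →
        ∃ g : U ⟶ FGModuleCat.of A (RegularDual R A E), g.hom.hom u ≠ 0 := by
  have := hE.finite
  let I := FGModuleCat.of A (RegularDual R A E)
  let ev : (FGModuleCat.of A A ⟶ I) →ₗ[R] E :=
    { toFun := fun f => (f.hom.hom (1 : A) : RegularDual R A E) (1 : A)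
      map_add' := fun _ _ => rfl
      map_smul' := fun r f => by
        change ((algebraMap R A r • (f.hom.hom (1 : A)) : RegularDual R A E)) (1 : A) = _
        rw [RegularDual.algebraMap_smul]
        rfl }
  have hev : ∀ {U : FGModuleCat.{u} A} (u : U) (g : U ⟶ I), ev (elementHom U u ≫ g) =
      (g.hom.hom u : RegularDual R A E) (1 : A) := fun u g => by
    change (g.hom.hom ((1 : A) • u) : RegularDual R A E) (1 : A) = _
    rw [one_smul]
  have hmul : ∀ {U : FGModuleCat.{u} A} (u : U) (g : U ⟶ I) (a : A),
      (g.hom.hom u : RegularDual R A E) a = (g.hom.hom (a • u) : RegularDual R A E) (1 : A) :=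
    fun u g a => by
      rw [map_smul]
      change _ = (g.hom.hom u : RegularDual R A E) (1 * a)
      rw [one_mul]
  let (U : FGModuleCat.{u} A) : Module R U := Module.compHom U (algebraMap R A)
  have (U : FGModuleCat.{u} A) : IsScalarTower R A U :=
    IsScalarTower.of_algebraMap_smul fun _ _ => rfl
  have (U : FGModuleCat.{u} A) : Module.Finite R U := Module.Finite.trans A U
  let coind : ∀ (U : FGModuleCat.{u} A), (U →ₗ[R] E) →ₗ[R] (U ⟶ I) := fun U =>
    { toFun := fun h => ObjectProperty.homMk (ModuleCat.ofHom
        { toFun := fun u => (show RegularDual R A E from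
            h ∘ₗ ((LinearMap.toSpanSingleton A U u).restrictScalars R))
          map_add' := fun x y => by
            ext a
            change h (a • (x + y)) = h (a • x) + h (a • y)
            rw [smul_add, map_add]
          map_smul' := fun b x => by
            ext a
            change h (a • b • x) = h ((a * b) • x)
            rw [mul_smul] })
      map_add' := fun _ _ => rfl
      map_smul' := fun r f => by
        apply hom_ext
        ext u a
        change r • f (a • u) = f ((a * algebraMap R A r) • u)
        rw [← map_smul, ← Algebra.commutes, mul_smul]
        rfl }
  have hcoind : ∀ {U : FGModuleCat.{u} A} (h : U →ₗ[R] E) (u : U),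
      (((coind U h).hom.hom u : RegularDual R A E) (1 : A)) = h u := fun h u => by
    change h ((1 : A) • u) = h u
    rw [one_smul]
  refine ⟨ev, ⟨fun {U} ψ => ?_, fun {U} ψ => ?_, fun {U} g hg => ?_, fun {U} f hf => ?_⟩,
    fun U u hu => ?_⟩
  · let h : U →ₗ[R] E :=
      { toFun := fun u => ψ (elementHom U u)
        map_add' := fun x y => by
          rw [← map_add]
          congr 1
          apply hom_ext
          ext
          exact smul_add _ _ _
        map_smul' := fun r x => by
          rw [RingHom.id_apply, ← map_smul]
          congr 1
          apply hom_ext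
          ext
          change (1 : A) • algebraMap R A r • x = algebraMap R A r • (1 : A) • x
          simp }
    refine ⟨coind U h, fun f => ?_⟩
    conv_rhs => rw [← elementHom_hom_one f, hev, hcoind]
    change _ = ψ (elementHom U (f.hom.hom (1 : A)))
    rw [elementHom_hom_one]
  · obtain ⟨u, hu⟩ := hE.exists_eq_eval U (ψ ∘ₗ coind U)
    refine ⟨elementHom U u, fun g => ?_⟩
    let h : U →ₗ[R] E :=
      { toFun := fun u => (g.hom.hom u : RegularDual R A E) (1 : A)
        map_add' := fun x y => by rw [map_add]; rfl
        map_smul' := fun r x => by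
          change (g.hom.hom (algebraMap R A r • x) : RegularDual R A E) (1 : A) = _
          rw [map_smul]
          rw [RegularDual.algebraMap_smul]
          rfl }
    have hg : coind U h = g := by
      apply hom_ext
      ext u a
      rw [hmul, hcoind, hmul]
      rfl
    rw [hev, ← hg]
    exact (hu h).trans (hcoind h u).symm
  · apply hom_ext
    ext u a
    rw [hmul, ← hev, hg]
    rfl
  · by_contra hne
    have hu : f.hom.hom (1 : A) ≠ 0 := fun h0 => hne (by
      rw [← elementHom_hom_one f, h0]
      apply hom_ext
      ext
      exact smul_zero _)
    obtain ⟨h, hh⟩ := hE.exists_ne_zero U _ hu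
    refine hh ?_
    rw [← hcoind, ← hev, elementHom_hom_one, hf]
  · obtain ⟨h, hh⟩ := hE.exists_ne_zero U _ hu
    exact ⟨coind U h, fun h0 => hh (by rw [← hcoind, h0]; rfl)⟩

end FGModuleCat

namespace CategoryTheory

/-- A linear category has enough Nakayama pairs if every object is a quotient of the first object
of such a pair, and a subobject of the second object of such a pair. -/
structure HasEnoughNakayamaPairs (R : Type w) [CommRing R] (E : Type v) [AddCommGroup E]
    [Module R E] (C : Type u) [Category.{v} C] [Preadditive C] [Linear R C] : Prop where
  exists_epi : ∀ M : C, ∃ (P I : C) (φ : (P ⟶ I) →ₗ[R] E), IsNakayamaPair φ ∧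
    ∃ e : P ⟶ M, Epi e
  exists_mono : ∀ M : C, ∃ (P I : C) (φ : (P ⟶ I) →ₗ[R] E), IsNakayamaPair φ ∧
    ∃ m : M ⟶ I, Mono m

end CategoryTheory

namespace FGModuleCat

section

variable {R : Type u} [CommRing R] [IsArtinianRing R] {A : Type u} [Ring A] [Algebra R A]
  [Module.Finite R A] [IsNoetherianRing A] {E : Type u} [AddCommGroup E] [Module R E]

theorem hasEnoughNakayamaPairs (hE : IsMatlisModule R E) :
    HasEnoughNakayamaPairs R E (FGModuleCat.{u} A) := by
  have := hE.finite
  have : HasFiniteBiproducts (FGModuleCat.{u} A) := Abelian.hasFiniteBiproducts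
  obtain ⟨φ, hφ, hsep⟩ := exists_isNakayamaPair_regular (R := R) (A := A) hE
  constructor
  · intro M
    have := finite_hom (R := R) (FGModuleCat.of A A) M
    obtain ⟨n, f, hf⟩ := Module.Finite.exists_fin (R := R) (M := FGModuleCat.of A A ⟶ M)
    obtain ⟨φ', hφ'⟩ := IsNakayamaPair.exists_biproduct (fun _ : Fin n => φ) (fun _ => hφ)
    refine ⟨_, _, φ', hφ', biproduct.desc f, Preadditive.epi_of_cancel_zero _ fun {X} h hh => ?_⟩
    have h1 : Linear.rightComp R (FGModuleCat.of A A) h = 0 := by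
      refine LinearMap.ext_on_range hf fun i => ?_
      simpa using biproduct.ι _ i ≫= hh
    apply hom_ext
    ext x
    have h2 := congrArg (fun g => g.hom.hom (1 : A)) (LinearMap.congr_fun h1 (elementHom M x))
    change h.hom.hom ((1 : A) • x) = 0 at h2
    rwa [one_smul] at h2
  · intro M
    have := finite_hom (R := R) M (FGModuleCat.of A (RegularDual R A E))
    obtain ⟨n, f, hf⟩ := Module.Finite.exists_fin (R := R)
      (M := M ⟶ FGModuleCat.of A (RegularDual R A E))
    obtain ⟨φ', hφ'⟩ := IsNakayamaPair.exists_biproduct (fun _ : Fin n => φ) (fun _ => hφ)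
    refine ⟨_, _, φ', hφ', biproduct.lift f, Preadditive.mono_of_cancel_zero _ fun {X} h hh => ?_⟩
    have h1 : Linear.leftComp R (FGModuleCat.of A (RegularDual R A E)) h = 0 := by
      refine LinearMap.ext_on_range hf fun i => ?_
      simpa using hh =≫ biproduct.π _ i
    apply hom_ext
    ext x
    by_contra hne
    obtain ⟨g, hg⟩ := hsep M _ hne
    exact hg (congrArg (fun g => g.hom.hom x) (LinearMap.congr_fun h1 g))

end

section

variable {A : Type u} [Ring A] [IsNoetherianRing A]

theorem exists_epi_of_free (M : FGModuleCat.{u} A) : ∃ (P : FGModuleCat.{u} A) (e : P ⟶ M),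
    Epi e ∧ Projective ((forget₂ (FGModuleCat A) (ModuleCat.{u} A)).obj P) := by
  obtain ⟨n, s, hs⟩ := Module.Finite.exists_fin (R := A) (M := M)
  let e : FGModuleCat.of A (Fin n → A) ⟶ M :=
    ObjectProperty.homMk (ModuleCat.ofHom (Fintype.linearCombination A s))
  refine ⟨FGModuleCat.of A (Fin n → A), e, ?_, ?_⟩
  · have : Epi ((forget₂ (FGModuleCat A) (ModuleCat.{u} A)).map e) := by
      refine (ModuleCat.epi_iff_surjective _).2 (LinearMap.range_eq_top.1 ?_)
      exact (Fintype.range_linearCombination A s).trans hs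
    exact (forget₂ (FGModuleCat A) (ModuleCat.{u} A)).epi_of_epi_map this
  · exact (IsProjective.iff_projective (R := A) (Fin n → A)).1 inferInstance

theorem hasProjectiveDimensionLT (n : ℕ) : ∀ (M : FGModuleCat.{u} A),
    HasProjectiveDimensionLT ((forget₂ (FGModuleCat A) (ModuleCat.{u} A)).obj M) n →
      HasProjectiveDimensionLT M n := by
  let F := forget₂ (FGModuleCat A) (ModuleCat.{u} A)
  induction n with
  | zero =>
    intro M hM
    rw [hasProjectiveDimensionLT_zero_iff_isZero] at hM ⊢
    rw [IsZero.iff_id_eq_zero] at hM ⊢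
    exact F.map_injective (by rw [F.map_id, hM, F.map_zero])
  | succ n ih =>
    intro M hM
    obtain ⟨P, e, he, hP⟩ := exists_epi_of_free M
    have hS : (ShortComplex.mk (kernel.ι e) e (by simp)).ShortExact :=
      { exact := ShortComplex.exact_kernel e }
    have hFS := hS.map_of_exact F
    have hP' : Projective P := F.projective_of_map_projective hP
    cases n with
    | zero =>
      have : Projective (F.obj M) := projective_iff_hasProjectiveDimensionLT_one.2 hM
      have : Projective M := F.projective_of_map_projective this
      infer_instance
    | succ n =>
      have h₁ : HasProjectiveDimensionLT (F.obj P) (n + 1) :=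
        have := hP
        hasProjectiveDimensionLT_of_ge (F.obj P) 1 _ (by omega)
      have := ih _ (hFS.hasProjectiveDimensionLT_X₁ (n + 1)
        h₁ hM)
      exact hS.hasProjectiveDimensionLT_X₃ _ this
        (hasProjectiveDimensionLT_of_ge P 1 _ (by omega))

end

end FGModuleCat

/-! ### Bounded complexes and contractible disk complexes -/

namespace CochainComplex

open HomComplex

section

variable {C : Type u} [Category.{v} C] [Abelian C]

/-- A complex is finitely supported if its terms vanish outside of a finite set. -/
def IsFinitelySupported (K : CochainComplex C ℤ) : Prop :=
  ∃ s : Finset ℤ, ∀ i ∉ s, IsZero (K.X i)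

theorem bounded_iff_isFinitelySupported (K : CochainComplex C ℤ) :
    HomotopyCategory.bounded C ((HomotopyCategory.quotient _ _).obj K) ↔
      K.IsFinitelySupported := by
  rw [HomotopyCategory.bounded_quotient_obj_iff]
  constructor
  · rintro ⟨a, b, _, _⟩
    refine ⟨Finset.Icc a b, fun i hi => ?_⟩
    rw [Finset.mem_Icc, not_and_or, not_le, not_le] at hi
    obtain hi | hi := hi
    · exact K.isZero_of_isStrictlyGE a i hi
    · exact K.isZero_of_isStrictlyLE b i hi
  · rintro ⟨s, hs⟩
    obtain ⟨a, ha⟩ := s.bddBelow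
    obtain ⟨b, hb⟩ := s.bddAbove
    exact ⟨a, b, (isStrictlyGE_iff _ _).2 fun i hi => hs i fun h => not_le.2 hi (ha h),
      (isStrictlyLE_iff _ _).2 fun i hi => hs i fun h => not_le.2 hi (hb h)⟩

theorem IsFinitelySupported.of_mono {K L : CochainComplex C ℤ} (hL : L.IsFinitelySupported)
    (f : K ⟶ L) [Mono f] : K.IsFinitelySupported := by
  obtain ⟨s, hs⟩ := hL
  exact ⟨s, fun i hi => (hs i hi).of_mono (f.f i)⟩

theorem IsFinitelySupported.of_epi {K L : CochainComplex C ℤ} (hK : K.IsFinitelySupported)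
    (f : K ⟶ L) [Epi f] : L.IsFinitelySupported := by
  obtain ⟨s, hs⟩ := hK
  exact ⟨s, fun i hi => (hs i hi).of_epi (f.f i)⟩

theorem IsFinitelySupported.mappingCone {K L : CochainComplex C ℤ} (hK : K.IsFinitelySupported)
    (hL : L.IsFinitelySupported) (f : K ⟶ L) : (mappingCone f).IsFinitelySupported := by
  rw [← bounded_iff_isFinitelySupported] at hK hL ⊢
  exact HomotopyCategory.bounded_mappingCone C f hK hL

/-- The complex with zero differentials. -/
abbrev zeroDifferential (Q : ℤ → C) : CochainComplex C ℤ where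
  X := Q
  d _ _ := 0

/-- The direct sum of the complexes `Q (i + 1) ⟶ Q (i + 1)` (an identity), which are concentrated
in degrees `i` and `i + 1`. -/
noncomputable abbrev disk (Q : ℤ → C) : CochainComplex C ℤ := mappingCone (𝟙 (zeroDifferential Q))

namespace disk

variable (Q : ℤ → C)

/-- The inclusion of the generators of a disk complex. -/
noncomputable def ι (i : ℤ) : Q (i + 1) ⟶ (disk Q).X i :=
  (mappingCone.inl (𝟙 (zeroDifferential Q))).v (i + 1) i (by omega)

/-- The projection to the cogenerators of a disk complex. -/
noncomputable def π (i : ℤ) : (disk Q).X i ⟶ Q i :=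
  (mappingCone.snd (𝟙 (zeroDifferential Q))).v i i (add_zero i)

theorem isFinitelySupported (s : Finset ℤ) (hs : ∀ i ∉ s, IsZero (Q i)) :
    (disk Q).IsFinitelySupported :=
  IsFinitelySupported.mappingCone ⟨s, hs⟩ ⟨s, hs⟩ _

variable {Q} {U : CochainComplex C ℤ}

theorem hom_ext_from {f g : disk Q ⟶ U} (h : ∀ i, ι Q i ≫ f.f i = ι Q i ≫ g.f i) : f = g := by
  have hd : ∀ j, (mappingCone.inr (𝟙 (zeroDifferential Q))).f j =
      (mappingCone.inl (𝟙 (zeroDifferential Q))).v j (j - 1) (by omega) ≫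
        (mappingCone (𝟙 (zeroDifferential Q))).d (j - 1) j := fun j => by
    rw [mappingCone.inl_v_d _ j (j - 1) (j + 1) (by omega) (by omega)]
    simp
  have h' : ∀ i j (hij : i + (-1) = j),
      (mappingCone.inl (𝟙 (zeroDifferential Q))).v i j hij ≫ f.f j =
      (mappingCone.inl (𝟙 (zeroDifferential Q))).v i j hij ≫ g.f j := by
    intro i j hij
    obtain rfl : i = j + 1 := by omega
    exact h j
  ext j
  refine mappingCone.ext_from _ (j + 1) j rfl (h j) ?_
  rw [hd, Category.assoc, Category.assoc]
  have h1 := f.comm (j - 1) j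
  have h2 := g.comm (j - 1) j
  rw [← h1, ← h2, ← Category.assoc, ← Category.assoc, h' j (j - 1)]

theorem existsUnique_desc (a : ∀ i, Q (i + 1) ⟶ U.X i) :
    ∃! f : disk Q ⟶ U, ∀ i, ι Q i ≫ f.f i = a i := by
  let α : Cochain (zeroDifferential Q) U (-1) := Cochain.mk fun p q hpq =>
    ((zeroDifferential Q).XIsoOfEq (by omega : p = q + 1)).hom ≫ a q
  have h : ∀ i, ι Q i ≫ (mappingCone.desc (𝟙 (zeroDifferential Q)) α
      (Cocycle.homOf (Cocycle.mk (δ (-1) 0 α) 1 rfl (δ_δ _ _ _ _))) (by simp)).f i = a i :=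
    fun i => (mappingCone.inl_v_desc_f _ _ _ _ _ _ _).trans (by simp [α])
  exact ⟨_, h, fun g hg => hom_ext_from fun i => by rw [hg, h]⟩

theorem hom_ext_to {f g : U ⟶ disk Q} (h : ∀ i, f.f i ≫ π Q i = g.f i ≫ π Q i) : f = g := by
  have hd : ∀ i, (mappingCone.fst (𝟙 (zeroDifferential Q))).1.v i (i + 1) rfl =
      (mappingCone (𝟙 (zeroDifferential Q))).d i (i + 1) ≫
        (mappingCone.snd (𝟙 (zeroDifferential Q))).v (i + 1) (i + 1) (by omega) := fun i => by
    rw [mappingCone.d_snd_v _ i (i + 1) rfl]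
    simp
  ext i
  refine mappingCone.ext_to _ i (i + 1) rfl ?_ (h i)
  rw [hd, ← Category.assoc, ← Category.assoc]
  have h1 := f.comm i (i + 1)
  have h2 := g.comm i (i + 1)
  rw [h1, h2, Category.assoc, Category.assoc]
  exact congrArg _ (h (i + 1))

theorem existsUnique_lift (b : ∀ i, U.X i ⟶ Q i) :
    ∃! f : U ⟶ disk Q, ∀ i, f.f i ≫ π Q i = b i := by
  let β : Cochain U (zeroDifferential Q) 0 := Cochain.ofHoms b
  have h : ∀ i, (mappingCone.lift (𝟙 (zeroDifferential Q))
      (Cocycle.mk (-δ 0 1 β) 2 rfl (by simp [δ_δ])) β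
      (by simp [Cochain.comp_id])).f i ≫ π Q i = b i := fun i =>
    (mappingCone.lift_f_snd_v _ _ _ _ _ _ _).trans (by simp [β])
  exact ⟨_, h, fun g hg => hom_ext_to fun i => by rw [hg, h]⟩

end disk

end

end CochainComplex

/-! ### Serre duality in the homotopy category of bounded complexes -/

namespace CategoryTheory

section

variable {R : Type w} [CommRing R] {E : Type v} [AddCommGroup E] [Module R E]
variable {C : Type u} [Category.{v} C] [Preadditive C] [Linear R C]

/-- A linear form `φ` on `P ⟶ I` such that `U ⟶ I` identifies with the dual of `P ⟶ U` through
the composition followed by `φ`. -/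
structure IsRightNakayamaPair {P I : C} (φ : (P ⟶ I) →ₗ[R] E) : Prop where
  exists_right : ∀ {U : C} (ψ : (P ⟶ U) →ₗ[R] E), ∃ g : U ⟶ I, ∀ f, ψ f = φ (f ≫ g)
  right_eq_zero : ∀ {U : C} (g : U ⟶ I), (∀ f : P ⟶ U, φ (f ≫ g) = 0) → g = 0

theorem IsNakayamaPair.of_isZero {P I : C} (hP : IsZero P) (hI : IsZero I) :
    IsNakayamaPair (0 : (P ⟶ I) →ₗ[R] E) where
  exists_right ψ := ⟨0, fun f => by simp [hP.eq_of_src f 0]⟩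
  exists_left ψ := ⟨0, fun g => by simp [hI.eq_of_tgt g 0]⟩
  right_eq_zero g _ := hI.eq_of_tgt _ _
  left_eq_zero f _ := hP.eq_of_src _ _

end

theorem IsRightNakayamaPair.isNakayamaPair {R : Type v} [CommRing R] {E : Type v}
    [AddCommGroup E] [Module R E] {C : Type u} [Category.{v} C] [Preadditive C] [Linear R C]
    {P I : C} {φ : (P ⟶ I) →ₗ[R] E} (hφ : IsRightNakayamaPair φ) (hE : IsMatlisModule R E)
    (hP : ∀ U : C, Module.Finite R (P ⟶ U)) : IsNakayamaPair φ where
  exists_right := hφ.exists_right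
  right_eq_zero := hφ.right_eq_zero
  left_eq_zero {U} f hf := by
    by_contra h
    obtain ⟨ψ, hψ⟩ := hE.exists_ne_zero (P ⟶ U) f h
    obtain ⟨g, hg⟩ := hφ.exists_right ψ
    exact hψ (by rw [hg, hf])
  exists_left {U} ψ := by
    let L : (U ⟶ I) ≃ₗ[R] ((P ⟶ U) →ₗ[R] E) := LinearEquiv.ofBijective
      { toFun := fun g => φ ∘ₗ Linear.rightComp R P g
        map_add' := fun _ _ => by ext; simp
        map_smul' := fun _ _ => by ext; simp }
      ⟨(injective_iff_map_eq_zero _).2 fun g hg =>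
        hφ.right_eq_zero g fun f => LinearMap.congr_fun hg f,
        fun ψ => (hφ.exists_right ψ).imp fun g hg => by ext f; exact (hg f).symm⟩
    have := hP U
    obtain ⟨f, hf⟩ := hE.exists_eq_eval (P ⟶ U) (ψ ∘ₗ L.symm.toLinearMap)
    refine ⟨f, fun g => ?_⟩
    have h := hf (L g)
    rw [LinearMap.comp_apply, LinearEquiv.coe_coe, LinearEquiv.symm_apply_apply] at h
    exact h

end CategoryTheory

namespace CochainComplex

open HomComplex

variable {R : Type v} [CommRing R] {E : Type v} [AddCommGroup E] [Module R E]
variable {C : Type u} [Category.{v} C] [Abelian C] [Linear R C]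

instance (i : ℤ) : (HomologicalComplex.eval C (ComplexShape.up ℤ) i).Linear R where

theorem disk.exists_isNakayamaPair {Q J : ℤ → C} (φ : ∀ i, (Q (i + 1) ⟶ J i) →ₗ[R] E)
    (hφ : ∀ i, IsNakayamaPair (φ i)) (s : Finset ℤ) (hQ : ∀ i ∉ s, IsZero (Q (i + 1)))
    (hJ : ∀ i ∉ s, IsZero (J i)) :
    ∃ φ : (disk Q ⟶ disk J) →ₗ[R] E, IsNakayamaPair φ := by
  classical
  refine ⟨_, IsNakayamaPair.of_family (ι := s)
    (fun i => HomologicalComplex.eval C (ComplexShape.up ℤ) i)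
    (fun i => disk.ι Q i) (fun i => disk.π J i) (fun i => φ i) (fun i => hφ i) ?_ ?_⟩
  · intro U f
    obtain ⟨g, hg, hg'⟩ := disk.existsUnique_desc (Q := Q) (U := U)
      (fun i => if hi : i ∈ s then f ⟨i, hi⟩ else 0)
    refine ⟨g, fun i => (hg i).trans (dif_pos i.2), fun g' h => hg' g' fun i => ?_⟩
    by_cases hi : i ∈ s
    · exact (h ⟨i, hi⟩).trans (by simp [hi])
    · exact (hQ i hi).eq_of_src _ _
  · intro U f
    obtain ⟨g, hg, hg'⟩ := disk.existsUnique_lift (Q := J) (U := U)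
      (fun i => if hi : i ∈ s then f ⟨i, hi⟩ else 0)
    refine ⟨g, fun i => (hg i).trans (dif_pos i.2), fun g' h => hg' g' fun i => ?_⟩
    by_cases hi : i ∈ s
    · exact (h ⟨i, hi⟩).trans (by simp [hi])
    · exact (hJ i hi).eq_of_tgt _ _

theorem isZero_quotient_obj_disk (Q : ℤ → C) :
    IsZero ((HomotopyCategory.quotient C (ComplexShape.up ℤ)).obj (disk Q)) :=
  (HomotopyCategory.isZero_quotient_obj_iff _).2 ⟨mappingCone.homotopyToZeroOfId _⟩

theorem exists_δ_eq_ofHom {K L : CochainComplex C ℤ} (f : K ⟶ L)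
    (hf : (HomotopyCategory.quotient C (ComplexShape.up ℤ)).map f = 0) :
    ∃ κ : Cochain K L (-1), δ (-1) 0 κ = Cochain.ofHom f := by
  have h := Cochain.equivHomotopy f 0 (HomotopyCategory.homotopyOfEq _ _ (by simp [hf]))
  exact ⟨h.1, by simpa using h.2.symm⟩

theorem _root_.CategoryTheory.HasEnoughNakayamaPairs.exists_epi_disk
    (hC : HasEnoughNakayamaPairs R E C) (X : CochainComplex C ℤ) (hX : X.IsFinitelySupported) :
    ∃ (Q J : ℤ → C) (φ : (disk Q ⟶ disk J) →ₗ[R] E), IsNakayamaPair φ ∧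
      (disk Q).IsFinitelySupported ∧ (disk J).IsFinitelySupported ∧
      (∀ i, ∃ (P : C) (φ : (Q i ⟶ P) →ₗ[R] E), IsNakayamaPair φ) ∧
      ∃ e : disk Q ⟶ X, Epi e := by
  have h : ∀ M : C, ∃ (P I : C) (φ : (P ⟶ I) →ₗ[R] E), IsNakayamaPair φ ∧
      (IsZero M → IsZero P) ∧ (IsZero M → IsZero I) ∧ ∃ e : P ⟶ M, Epi e := by
    intro M
    by_cases hM : IsZero M
    · exact ⟨M, M, 0, IsNakayamaPair.of_isZero hM hM, id, id, 𝟙 M, inferInstance⟩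
    · obtain ⟨P, I, φ, h, he⟩ := hC.exists_epi M
      exact ⟨P, I, φ, h, fun h => (hM h).elim, fun h => (hM h).elim, he⟩
  choose P I φ hφ hP hI e he using h
  obtain ⟨s, hs⟩ := hX
  have hs' : ∀ i ∉ s, IsZero (X.X (i + 1 - 1)) := fun i hi => by simpa using hs i hi
  let t := s.map (addRightEmbedding 1)
  have ht : ∀ i ∉ t, IsZero (X.X (i - 1)) := fun i hi =>
    hs _ fun h => hi (Finset.mem_map.2 ⟨_, h, by simp⟩)
  obtain ⟨φ', hφ'⟩ := disk.exists_isNakayamaPair (Q := fun i => P (X.X (i - 1)))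
    (J := fun i => I (X.X (i + 1 - 1))) (fun i => φ _) (fun i => hφ _) s
    (fun i hi => hP _ (hs' i hi)) (fun i hi => hI _ (hs' i hi))
  obtain ⟨f, hf, -⟩ := disk.existsUnique_desc (Q := fun i => P (X.X (i - 1))) (U := X)
    (fun i => e _ ≫ (X.XIsoOfEq (by omega)).hom)
  refine ⟨_, _, φ', hφ', disk.isFinitelySupported _ t fun i hi => hP _ (ht i hi),
    disk.isFinitelySupported _ s fun i hi => hI _ (hs' i hi), fun i => ⟨_, _, hφ _⟩, f, ?_⟩
  have : ∀ i, Epi (f.f i) := fun i => by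
    have := he (X.X (i + 1 - 1))
    have h : Epi (disk.ι _ i ≫ f.f i) := by
      rw [hf i]
      infer_instance
    exact epi_of_epi (disk.ι _ i) (f.f i)
  exact HomologicalComplex.epi_of_epi_f f this

theorem _root_.CategoryTheory.HasEnoughNakayamaPairs.exists_mono_disk
    (hC : HasEnoughNakayamaPairs R E C) (X : CochainComplex C ℤ) (hX : X.IsFinitelySupported) :
    ∃ (Q J : ℤ → C) (φ : (disk Q ⟶ disk J) →ₗ[R] E), IsNakayamaPair φ ∧
      (disk Q).IsFinitelySupported ∧ (disk J).IsFinitelySupported ∧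
      (∀ i, ∃ (P : C) (φ : (P ⟶ J i) →ₗ[R] E), IsNakayamaPair φ) ∧
      ∃ e : X ⟶ disk J, Mono e := by
  have h : ∀ M : C, ∃ (P I : C) (φ : (P ⟶ I) →ₗ[R] E), IsNakayamaPair φ ∧
      (IsZero M → IsZero P) ∧ (IsZero M → IsZero I) ∧ ∃ e : M ⟶ I, Mono e := by
    intro M
    by_cases hM : IsZero M
    · exact ⟨M, M, 0, IsNakayamaPair.of_isZero hM hM, id, id, 𝟙 M, inferInstance⟩
    · obtain ⟨P, I, φ, h, he⟩ := hC.exists_mono M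
      exact ⟨P, I, φ, h, fun h => (hM h).elim, fun h => (hM h).elim, he⟩
  choose P I φ hφ hP hI e he using h
  obtain ⟨s, hs⟩ := hX
  have hs' : ∀ i ∉ s, IsZero (X.X (i + 1 - 1)) := fun i hi => by simpa using hs i hi
  let t := s.map (addRightEmbedding 1)
  have ht : ∀ i ∉ t, IsZero (X.X (i - 1)) := fun i hi =>
    hs _ fun h => hi (Finset.mem_map.2 ⟨_, h, by simp⟩)
  obtain ⟨φ', hφ'⟩ := disk.exists_isNakayamaPair (Q := fun i => P (X.X (i - 1)))
    (J := fun i => I (X.X (i + 1 - 1))) (fun i => φ _) (fun i => hφ _) s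
    (fun i hi => hP _ (hs' i hi)) (fun i hi => hI _ (hs' i hi))
  obtain ⟨f, hf, -⟩ := disk.existsUnique_lift (Q := fun i => I (X.X (i + 1 - 1))) (U := X)
    (fun i => (X.XIsoOfEq (by omega)).hom ≫ e _)
  refine ⟨_, _, φ', hφ', disk.isFinitelySupported _ t fun i hi => hP _ (ht i hi),
    disk.isFinitelySupported _ s fun i hi => hI _ (hs' i hi), fun i => ⟨_, _, hφ _⟩, f, ?_⟩
  have : ∀ i, Mono (f.f i) := fun i => by
    have := he (X.X (i + 1 - 1))
    have h : Mono (f.f i ≫ disk.π _ i) := by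
      rw [hf i]
      infer_instance
    exact mono_of_mono (f.f i) (disk.π _ i)
  exact HomologicalComplex.mono_of_mono_f f this

end CochainComplex

namespace CochainComplex

open HomComplex

section

variable {C : Type u} [Category.{v} C] [Abelian C]

theorem HomComplex.Cochain.comp_ofHom_injective {U K L : CochainComplex C ℤ} (f : K ⟶ L) [Mono f]
    {n : ℤ} {z z' : Cochain U K n}
    (h : z.comp (Cochain.ofHom f) (add_zero n) = z'.comp (Cochain.ofHom f) (add_zero n)) :
    z = z' := by
  ext p q hpq
  rw [← cancel_mono (f.f q)]
  simpa using Cochain.congr_v h p q hpq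

theorem HomComplex.Cochain.exists_lift {U : CochainComplex C ℤ}
    (S : ShortComplex (CochainComplex C ℤ))
    (hS : S.Exact) [Mono S.f] {n : ℤ} (z : Cochain U S.X₂ n)
    (hz : z.comp (Cochain.ofHom S.g) (add_zero n) = 0) :
    ∃ z' : Cochain U S.X₁ n, z'.comp (Cochain.ofHom S.f) (add_zero n) = z := by
  have hex : ∀ i, (S.map (HomologicalComplex.eval C (ComplexShape.up ℤ) i)).Exact := fun i =>
    hS.map _
  have hm : ∀ i, Mono (S.map (HomologicalComplex.eval C (ComplexShape.up ℤ) i)).f := fun i =>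
    inferInstanceAs (Mono (S.f.f i))
  have h0 : ∀ p q hpq, ∃ l : U.X p ⟶ S.X₁.X q, l ≫ S.f.f q = z.v p q hpq := fun p q hpq =>
    ⟨(hex q).lift (z.v p q hpq)
      (by simpa using Cochain.congr_v hz p q hpq : z.v p q hpq ≫ S.g.f q = 0),
      (hex q).lift_f (z.v p q hpq) _⟩
  choose l hl using h0
  refine ⟨Cochain.mk l, ?_⟩
  ext p q hpq
  simp [hl]

end

section

variable {R : Type v} [CommRing R] {E : Type v} [AddCommGroup E] [Module R E]
variable {C : Type u} [Category.{v} C] [Abelian C] [Linear R C]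
variable (S : ShortComplex (CochainComplex C ℤ)) (S' : ShortComplex (CochainComplex C ℤ))
  (φ₁ : (S.X₁ ⟶ S'.X₂) →ₗ[R] E) (φ₀ : (S.X₂ ⟶ S'.X₃) →ₗ[R] E)

/-- If `S` is a presentation of `S.X₃` and `S'` a copresentation of `S'.X₁` which correspond to
each other through Nakayama pairs, maps to `S'.X₃` which are orthogonal to `S.X₃` lift to
`S'.X₂`. -/
theorem exists_lift_of_orthogonal (hE : IsMatlisModule R E) (hS : S.Exact) [Epi S.g]
    (hφ₁ : IsNakayamaPair φ₁) (hφ₀ : IsNakayamaPair φ₀)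
    (hφ : ∀ a : S.X₂ ⟶ S'.X₂, φ₁ (S.f ≫ a) = φ₀ (a ≫ S'.g))
    {U : CochainComplex C ℤ} (b : U ⟶ S'.X₃) (hb : ∀ f : S.X₃ ⟶ U, φ₀ (S.g ≫ f ≫ b) = 0) :
    ∃ b' : U ⟶ S'.X₂, b' ≫ S'.g = b := by
  obtain ⟨ζ, hζ⟩ := hE.exists_factor (Linear.leftComp R U S.f)
    (φ₀ ∘ₗ Linear.rightComp R S.X₂ b) (fun a (ha : S.f ≫ a = 0) => by
      rw [← hS.g_desc a ha]
      simpa using hb (hS.desc a ha))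
  obtain ⟨b', hb'⟩ := hφ₁.exists_right ζ
  refine ⟨b', sub_eq_zero.1 (hφ₀.right_eq_zero _ fun a => ?_)⟩
  have h := hζ a
  simp only [Linear.leftComp_apply, LinearMap.comp_apply, Linear.rightComp_apply, hb'] at h
  rw [Preadditive.comp_sub, map_sub, ← h, sub_eq_zero, ← Category.assoc a b' S'.g, ← hφ,
    Category.assoc]

/-- The map from the mapping cone of the first map of a short complex to its third object. -/
noncomputable def mappingConeToX₃ : mappingCone S'.f ⟶ S'.X₃ :=
  mappingCone.desc S'.f 0 S'.g (by simp)

theorem ofHom_mappingConeToX₃ : Cochain.ofHom (mappingConeToX₃ S') =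
    (mappingCone.snd S'.f).comp (Cochain.ofHom S'.g) (zero_add 0) := by
  simp [mappingConeToX₃, mappingCone.descCochain]

theorem exists_eq_comp_of_homotopic_zero {U : CochainComplex C ℤ} (h : U ⟶ mappingCone S'.f)
    (hh : (HomotopyCategory.quotient C (ComplexShape.up ℤ)).map h = 0) :
    ∃ (z : Cochain U S'.X₂ (-1)) (a : U ⟶ S'.X₂), Cochain.ofHom a = δ (-1) 0 z ∧
      h ≫ mappingConeToX₃ S' = a ≫ S'.g := by
  obtain ⟨z, hz⟩ := exists_δ_eq_ofHom h hh
  let z' := z.comp (mappingCone.snd S'.f) (add_zero (-1))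
  refine ⟨z', Cocycle.homOf (Cocycle.mk (δ (-1) 0 z') 1 rfl (δ_δ _ _ _ _)), by simp, ?_⟩
  apply Cochain.ofHom_injective
  rw [Cochain.ofHom_comp, Cochain.ofHom_comp, ← hz, ← δ_comp_ofHom, ofHom_mappingConeToX₃,
    Cocycle.cochain_ofHom_homOf_eq_coe, Cocycle.mk_coe, ← δ_comp_ofHom]
  simp [z']

theorem quotient_map_eq_zero_of_comp_mappingConeToX₃ (hS' : S'.Exact) [Mono S'.f]
    (hX₂ : IsZero ((HomotopyCategory.quotient C (ComplexShape.up ℤ)).obj S'.X₂))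
    {U : CochainComplex C ℤ} (g : U ⟶ mappingCone S'.f) (b' : U ⟶ S'.X₂)
    (hb' : b' ≫ S'.g = g ≫ mappingConeToX₃ S') :
    (HomotopyCategory.quotient C (ComplexShape.up ℤ)).map g = 0 := by
  obtain ⟨κ, hκ⟩ := exists_δ_eq_ofHom b' (hX₂.eq_of_tgt _ _)
  let s := (Cochain.ofHom g).comp (mappingCone.snd S'.f) (zero_add 0)
  obtain ⟨γ, hγ⟩ := Cochain.exists_lift S' hS' (s - Cochain.ofHom b') (by
    rw [Cochain.sub_comp, ← Cochain.ofHom_comp, hb', Cochain.ofHom_comp, ofHom_mappingConeToX₃]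
    simp [s])
  rw [HomotopyCategory.eq_of_homotopy g 0 (mappingCone.liftHomotopy S'.f g 0 γ κ ?_ ?_),
    Functor.map_zero]
  · apply Cochain.comp_ofHom_injective S'.f
    have h1 := congrArg (δ 0 1) hγ
    rw [δ_comp_ofHom, δ_sub, δ_ofHom, sub_zero, δ_ofHom_comp, mappingCone.δ_snd] at h1
    simp only [Cochain.ofHom_zero, Cochain.zero_comp, add_zero, Cochain.neg_comp, h1]
    simp
  · rw [hγ, hκ]
    simp [s]

theorem exists_isRightNakayamaPair_quotient (hE : IsMatlisModule R E) (hS : S.Exact) [Epi S.g]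
    (hS' : S'.Exact) [Mono S'.f]
    (hX₂ : IsZero ((HomotopyCategory.quotient C (ComplexShape.up ℤ)).obj S'.X₂))
    (hφ₁ : IsNakayamaPair φ₁) (hφ₀ : IsNakayamaPair φ₀)
    (hφ : ∀ a : S.X₂ ⟶ S'.X₂, φ₁ (S.f ≫ a) = φ₀ (a ≫ S'.g)) :
    ∃ φ : ((HomotopyCategory.quotient C (ComplexShape.up ℤ)).obj S.X₃ ⟶
      (HomotopyCategory.quotient C (ComplexShape.up ℤ)).obj (mappingCone S'.f)) →ₗ[R] E,
      IsRightNakayamaPair φ := by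
  let q := HomotopyCategory.quotient C (ComplexShape.up ℤ)
  obtain ⟨φ, hφφ⟩ := hE.exists_factor (q.mapLinearMap R (X := S.X₃) (Y := mappingCone S'.f))
    (φ₀ ∘ₗ Linear.leftComp R S'.X₃ S.g ∘ₗ Linear.rightComp R S.X₃ (mappingConeToX₃ S'))
    (fun h hh => by
      obtain ⟨z, a, ha, h1⟩ := exists_eq_comp_of_homotopic_zero S' h hh
      have h2 : S.f ≫ S.g ≫ a = 0 := by rw [← Category.assoc, S.zero, zero_comp]
      simp only [LinearMap.comp_apply, Linear.rightComp_apply, Linear.leftComp_apply, h1]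
      rw [← Category.assoc, ← hφ, h2, map_zero])
  replace hφφ : ∀ h : S.X₃ ⟶ mappingCone S'.f,
      φ (q.map h) = φ₀ (S.g ≫ h ≫ mappingConeToX₃ S') := hφφ
  refine ⟨φ, fun {U} ψ => ?_, fun {U} g hg => ?_⟩
  · obtain ⟨U, rfl⟩ := HomotopyCategory.quotient_obj_surjective U
    obtain ⟨ζ, hζ⟩ := hE.exists_extension (Linear.leftComp R U S.g)
      (fun a b h => (cancel_epi S.g).1 h) (ψ ∘ₗ q.mapLinearMap R)
    obtain ⟨b, hb⟩ := hφ₀.exists_right ζ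
    replace hζ : ∀ f : S.X₃ ⟶ U, φ₀ (S.g ≫ f ≫ b) = ψ (q.map f) := fun f => by
      have := hζ f
      simp only [Linear.leftComp_apply, hb, Category.assoc] at this
      exact this
    obtain ⟨c, hc, -⟩ := disk.existsUnique_desc (Q := fun i => U.X (i - 1)) (U := U)
      (fun i => (U.XIsoOfEq (by omega)).hom)
    obtain ⟨β', hβ'⟩ := exists_lift_of_orthogonal S S' φ₁ φ₀ hE hS hφ₁ hφ₀ hφ (c ≫ b) (fun f => by
      have := hζ (f ≫ c)
      rw [Category.assoc] at this
      rw [this, Functor.map_comp, (isZero_quotient_obj_disk _).eq_of_tgt (q.map f) 0, zero_comp,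
        map_zero])
    let β : Cochain U S'.X₂ 0 := Cochain.ofHoms fun i =>
      (U.XIsoOfEq (by omega)).inv ≫ disk.ι (fun i => U.X (i - 1)) i ≫ β'.f i
    have hβ : β.comp (Cochain.ofHom S'.g) (zero_add 0) = Cochain.ofHom b := by
      ext i
      have h1 := HomologicalComplex.congr_hom hβ' i
      simp only [HomologicalComplex.comp_f] at h1
      simp only [β, Cochain.comp_zero_cochain_v, Cochain.ofHoms_v, Cochain.ofHom_v,
        Category.assoc, h1]
      rw [← Category.assoc (disk.ι _ i), hc]
      simp
    obtain ⟨α, hα⟩ := Cochain.exists_lift S' hS' (-δ 0 1 β) (by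
      rw [Cochain.neg_comp, ← δ_comp_ofHom, hβ, δ_ofHom, neg_zero])
    have hα' : δ 1 2 α = 0 := Cochain.comp_ofHom_injective S'.f (by
      rw [← δ_comp_ofHom, hα, δ_neg, δ_δ, neg_zero, Cochain.zero_comp])
    let g := mappingCone.lift S'.f (Cocycle.mk α 2 rfl hα') β (by simp [hα])
    have hg : g ≫ mappingConeToX₃ S' = b := by
      apply Cochain.ofHom_injective
      rw [Cochain.ofHom_comp, ofHom_mappingConeToX₃, mappingCone.ofHom_lift,
        ← Cochain.comp_assoc_of_third_is_zero_cochain, mappingCone.liftCochain_snd, hβ]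
    refine ⟨q.map g, fun f => ?_⟩
    obtain ⟨f, rfl⟩ := q.map_surjective f
    rw [← hζ, ← Functor.map_comp, hφφ, Category.assoc, hg]
  · obtain ⟨U, rfl⟩ := HomotopyCategory.quotient_obj_surjective U
    obtain ⟨g, rfl⟩ := (HomotopyCategory.quotient _ _).map_surjective g
    obtain ⟨b', hb'⟩ := exists_lift_of_orthogonal S S' φ₁ φ₀ hE hS hφ₁ hφ₀ hφ
      (g ≫ mappingConeToX₃ S') (fun f => by
        have := hg (q.map f)
        erw [← Functor.map_comp, hφφ] at this
        rwa [Category.assoc] at this)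
    exact quotient_map_eq_zero_of_comp_mappingConeToX₃ S' hS' hX₂ g b' hb'

end

end CochainComplex

/-! ### Partners in the bounded homotopy category -/

namespace CategoryTheory

section

variable {R : Type w} [CommRing R] {E : Type v} [AddCommGroup E] [Module R E]
variable {C : Type u} [Category.{v} C] [Preadditive C] [Linear R C]

theorem IsRightNakayamaPair.of_iso {P I I' : C} {φ : (P ⟶ I) →ₗ[R] E}
    (hφ : IsRightNakayamaPair φ) (e : I ≅ I') :
    IsRightNakayamaPair (φ ∘ₗ Linear.rightComp R P e.inv) where
  exists_right {U} ψ := by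
    obtain ⟨g, hg⟩ := hφ.exists_right ψ
    exact ⟨g ≫ e.hom, fun f => by simp [hg]⟩
  right_eq_zero {U} g hg := by
    have := hφ.right_eq_zero (g ≫ e.inv) (fun f => by simpa using hg f)
    rw [← cancel_mono e.inv, this, zero_comp]

end

end CategoryTheory

namespace HomotopyCategory

open CochainComplex

variable {R : Type v} [CommRing R] {E : Type v} [AddCommGroup E] [Module R E]
variable {C : Type u} [Category.{v} C] [Abelian C] [Linear R C]

theorem nonempty_mappingCone_iso_shift {K L : CochainComplex C ℤ} (f : K ⟶ L)
    (hL : IsZero ((quotient C (ComplexShape.up ℤ)).obj L)) :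
    Nonempty ((quotient C (ComplexShape.up ℤ)).obj (mappingCone f) ≅
      ((quotient C (ComplexShape.up ℤ)).obj K)⟦(1 : ℤ)⟧) :=
  ⟨@asIso _ _ _ _ (mappingCone.triangleh f).mor₃
    ((Triangle.isZero₂_iff_isIso₃ _ (mappingCone_triangleh_distinguished f)).1 hL)⟩

theorem exists_isRightNakayamaPair_of_left (hE : IsMatlisModule R E)
    (hC : HasEnoughNakayamaPairs R E C)
    (X : HomotopyCategory C (ComplexShape.up ℤ)) (hX : bounded C X) :
    ∃ (V : HomotopyCategory C (ComplexShape.up ℤ)) (φ : (X ⟶ V) →ₗ[R] E), bounded C V ∧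
      IsRightNakayamaPair φ := by
  obtain ⟨X, rfl⟩ := HomotopyCategory.quotient_obj_surjective X
  rw [bounded_iff_isFinitelySupported] at hX
  obtain ⟨Q₀, J₀, φ₀, hφ₀, hQ₀, hJ₀, -, e₀, he₀⟩ := hC.exists_epi_disk X hX
  obtain ⟨Q₁, J₁, φ₁, hφ₁, hQ₁, hJ₁, -, e₁, he₁⟩ := hC.exists_epi_disk _
    (hQ₀.of_mono (kernel.ι e₀))
  let S : ShortComplex (CochainComplex C ℤ) := ShortComplex.mk (e₁ ≫ kernel.ι e₀) e₀ (by simp)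
  have hS : S.Exact := by
    rw [ShortComplex.exact_iff_epi_kernel_lift]
    have : kernel.lift S.g S.f S.zero = e₁ := by
      rw [← cancel_mono (kernel.ι _), kernel.lift_ι]
    rwa [this]
  obtain ⟨q, hq⟩ := hφ₀.exists_right (φ₁ ∘ₗ Linear.leftComp R (disk J₁) S.f)
  let S' : ShortComplex (CochainComplex C ℤ) := ShortComplex.mk (kernel.ι q) q (by simp)
  have hS' : S'.Exact := ShortComplex.exact_kernel q
  obtain ⟨φ, hφ⟩ := exists_isRightNakayamaPair_quotient S S' φ₁ φ₀ hE hS hS'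
    (isZero_quotient_obj_disk J₁) hφ₁ hφ₀ hq
  refine ⟨_, φ, ?_, hφ⟩
  rw [bounded_iff_isFinitelySupported]
  exact (hJ₁.of_mono (kernel.ι q)).mappingCone hJ₁ _

theorem exists_isRightNakayamaPair_of_right (hE : IsMatlisModule R E)
    (hC : HasEnoughNakayamaPairs R E C)
    (V : HomotopyCategory C (ComplexShape.up ℤ)) (hV : bounded C V) :
    ∃ (X : HomotopyCategory C (ComplexShape.up ℤ)) (φ : (X ⟶ V) →ₗ[R] E), bounded C X ∧
      IsRightNakayamaPair φ := by
  have hV' := (bounded C).le_shift (-1 : ℤ) _ hV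
  obtain ⟨Y, hY⟩ := HomotopyCategory.quotient_obj_surjective (V⟦(-1 : ℤ)⟧)
  rw [ObjectProperty.prop_shift_iff, ← hY, bounded_iff_isFinitelySupported] at hV'
  obtain ⟨Q₁, J₁, φ₁, hφ₁, hQ₁, hJ₁, -, e₁, he₁⟩ := hC.exists_mono_disk Y hV'
  obtain ⟨Q₀, J₀, φ₀, hφ₀, hQ₀, hJ₀, -, e₀, he₀⟩ := hC.exists_mono_disk _
    (hJ₁.of_epi (cokernel.π e₁))
  let S' : ShortComplex (CochainComplex C ℤ) := ShortComplex.mk e₁ (cokernel.π e₁ ≫ e₀) (by simp)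
  have hS' : S'.Exact := by
    rw [ShortComplex.exact_iff_mono_cokernel_desc]
    have : cokernel.desc S'.f S'.g S'.zero = e₀ := by
      rw [← cancel_epi (cokernel.π _), cokernel.π_desc]
    rwa [this]
  obtain ⟨p, hp⟩ := hφ₁.exists_left (φ₀ ∘ₗ Linear.rightComp R (disk Q₀) S'.g)
  let S : ShortComplex (CochainComplex C ℤ) := ShortComplex.mk p (cokernel.π p) (by simp)
  have hS : S.Exact := ShortComplex.exact_cokernel p
  obtain ⟨φ, hφ⟩ := exists_isRightNakayamaPair_quotient S S' φ₁ φ₀ hE hS hS'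
    (isZero_quotient_obj_disk J₁) hφ₁ hφ₀ (fun a => (hp a).symm)
  obtain ⟨e'⟩ := nonempty_mappingCone_iso_shift e₁ (isZero_quotient_obj_disk J₁)
  let e : (quotient C (ComplexShape.up ℤ)).obj (mappingCone e₁) ≅ V :=
    e' ≪≫ (CategoryTheory.shiftFunctor _ (1 : ℤ)).mapIso (eqToIso hY) ≪≫
      (shiftEquiv _ (1 : ℤ)).counitIso.app V
  refine ⟨_, _, ?_, hφ.of_iso e⟩
  rw [bounded_iff_isFinitelySupported]
  exact hQ₀.of_epi (cokernel.π p)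

variable (C) in
/-- The bounded acyclic complexes in the homotopy category. -/
abbrev boundedAcyclic : ObjectProperty (HomotopyCategory C (ComplexShape.up ℤ)) :=
  bounded C ⊓ subcategoryAcyclic C

theorem trW_boundedAcyclic_of_quasiIso {K L : CochainComplex C ℤ} (f : K ⟶ L) [QuasiIso f]
    (hK : K.IsFinitelySupported) (hL : L.IsFinitelySupported) :
    (boundedAcyclic C).trW ((quotient C (ComplexShape.up ℤ)).map f) := by
  have hT := mappingCone_triangleh_distinguished f
  refine ObjectProperty.trW.mk _ hT ⟨?_, ?_⟩
  · exact (bounded_iff_isFinitelySupported _).2 (hK.mappingCone hL f)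
  · refine ((subcategoryAcyclic C).trW_iff_of_distinguished _ hT).1 ?_
    rw [← quasiIso_eq_trW_subcategoryAcyclic]
    exact (quotient_map_mem_quasiIso_iff f).2
      ((HomologicalComplex.mem_quasiIso_iff f).2 inferInstance)

theorem _root_.CochainComplex.disk.injective (J : ℤ → C) (hJ : ∀ i, Injective (J i)) (i : ℤ) :
    Injective ((disk J).X i) := by
  have : Injective ((zeroDifferential J).X i) := hJ i
  have : Injective ((zeroDifferential J).X (i + 1)) := hJ (i + 1)
  exact Injective.of_iso
    (HomologicalComplex.homotopyCofiber.XIsoBiprod (𝟙 (zeroDifferential J)) i (i + 1) rfl).symm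
    inferInstance

theorem _root_.CochainComplex.disk.projective (Q : ℤ → C) (hQ : ∀ i, Projective (Q i)) (i : ℤ) :
    Projective ((disk Q).X i) := by
  have : Projective ((zeroDifferential Q).X i) := hQ i
  have : Projective ((zeroDifferential Q).X (i + 1)) := hQ (i + 1)
  exact Projective.of_iso
    (HomologicalComplex.homotopyCofiber.XIsoBiprod (𝟙 (zeroDifferential Q)) i (i + 1) rfl).symm
    inferInstance

theorem exists_trW_rightOrthogonal (hE : IsMatlisModule R E) (hC : HasEnoughNakayamaPairs R E C)
    (n : ℕ) : ∀ Z : CochainComplex C ℤ, Z.IsFinitelySupported →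
      (∀ i, HasInjectiveDimensionLT (Z.X i) (n + 1)) →
      ∃ (I : HomotopyCategory C (ComplexShape.up ℤ))
        (s : (quotient C (ComplexShape.up ℤ)).obj Z ⟶ I),
        (boundedAcyclic C).trW s ∧ (boundedAcyclic C).rightOrthogonal I := by
  induction n with
  | zero =>
    intro Z hZ hi
    obtain ⟨a, b, _, _⟩ :=
      (bounded_quotient_obj_iff C Z).1 ((bounded_iff_isFinitelySupported Z).2 hZ)
    have : ∀ i, Injective (Z.X i) := fun i => by
      have := hi i
      infer_instance
    have := isKInjective_of_injective Z a
    exact ⟨_, 𝟙 _, MorphismProperty.id_mem _ _,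
      fun U f hU => IsKInjective.rightOrthogonal Z f hU.2⟩
  | succ n ih =>
    intro Z hZ hi
    obtain ⟨Q, J, -, -, -, hJ, hJ', m, hm⟩ := hC.exists_mono_disk Z hZ
    let S := ShortComplex.mk m (cokernel.π m) (by simp)
    have hS : S.ShortExact := { exact := ShortComplex.exact_cokernel m }
    have hS₃ : S.X₃.IsFinitelySupported := hJ.of_epi (cokernel.π m)
    obtain ⟨I, s, hs, hI⟩ := ih S.X₃ hS₃ (fun i => by
      have h := hS.map_of_exact (HomologicalComplex.eval C (ComplexShape.up ℤ) i)
      have : Injective ((disk J).X i) := disk.injective J (fun i => by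
        obtain ⟨_, _, h⟩ := hJ' i
        exact h.injective hE) i
      exact h.hasInjectiveDimensionLT_X₃ (n + 1)
        (hasInjectiveDimensionLT_of_ge ((disk J).X i) 1 _ (by omega)) (hi i))
    have := mappingCone.quasiIso_descShortComplex hS
    obtain ⟨e⟩ := nonempty_mappingCone_iso_shift m (isZero_quotient_obj_disk J)
    let t := e.inv ≫ (quotient C (ComplexShape.up ℤ)).map (mappingCone.descShortComplex S) ≫ s
    have ht : (boundedAcyclic C).trW t :=
      MorphismProperty.RespectsIso.precomp _ _ _ (MorphismProperty.comp_mem _ _ _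
        (trW_boundedAcyclic_of_quasiIso _ (hZ.mappingCone hJ m) hS₃) hs)
    let e' := (shiftEquiv _ (1 : ℤ)).unitIso.app ((quotient C (ComplexShape.up ℤ)).obj Z)
    exact ⟨I⟦(-1 : ℤ)⟧, e'.hom ≫ t⟦(-1 : ℤ)⟧',
      MorphismProperty.RespectsIso.precomp _ e'.hom _ (ht.shift (-1)),
      (boundedAcyclic C).rightOrthogonal.le_shift (-1) _ hI⟩

theorem exists_trW_leftOrthogonal (hE : IsMatlisModule R E) (hC : HasEnoughNakayamaPairs R E C)
    (n : ℕ) : ∀ Z : CochainComplex C ℤ, Z.IsFinitelySupported →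
      (∀ i, HasProjectiveDimensionLT (Z.X i) (n + 1)) →
      ∃ (P : HomotopyCategory C (ComplexShape.up ℤ))
        (s : P ⟶ (quotient C (ComplexShape.up ℤ)).obj Z),
        (boundedAcyclic C).trW s ∧ (boundedAcyclic C).leftOrthogonal P := by
  induction n with
  | zero =>
    intro Z hZ hi
    obtain ⟨a, b, _, _⟩ :=
      (bounded_quotient_obj_iff C Z).1 ((bounded_iff_isFinitelySupported Z).2 hZ)
    have : ∀ i, Projective (Z.X i) := fun i => by
      have := hi i
      infer_instance
    have := isKProjective_of_projective Z b
    exact ⟨_, 𝟙 _, MorphismProperty.id_mem _ _,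
      fun U f hU => IsKProjective.leftOrthogonal Z f hU.2⟩
  | succ n ih =>
    intro Z hZ hi
    obtain ⟨Q, J, -, -, hQ, -, hQ', m, hm⟩ := hC.exists_epi_disk Z hZ
    let S := ShortComplex.mk (kernel.ι m) m (by simp)
    have hS : S.ShortExact := { exact := ShortComplex.exact_kernel m }
    have hS₁ : S.X₁.IsFinitelySupported := hQ.of_mono (kernel.ι m)
    obtain ⟨P, s, hs, hP⟩ := ih S.X₁ hS₁ (fun i => by
      have h := hS.map_of_exact (HomologicalComplex.eval C (ComplexShape.up ℤ) i)
      have : Projective ((disk Q).X i) := disk.projective Q (fun i => by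
        obtain ⟨_, _, h⟩ := hQ' i
        exact h.projective hE) i
      exact h.hasProjectiveDimensionLT_X₁ (n + 1)
        (hasProjectiveDimensionLT_of_ge ((disk Q).X i) 1 _ (by omega)) (hi i))
    have := mappingCone.quasiIso_descShortComplex hS
    obtain ⟨e⟩ := nonempty_mappingCone_iso_shift S.f (isZero_quotient_obj_disk Q)
    exact ⟨P⟦(1 : ℤ)⟧, s⟦(1 : ℤ)⟧' ≫ e.inv ≫
        (quotient C (ComplexShape.up ℤ)).map (mappingCone.descShortComplex S),
      MorphismProperty.comp_mem _ _ _ (hs.shift 1) (MorphismProperty.RespectsIso.precomp _ _ _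
        (trW_boundedAcyclic_of_quasiIso _ (hS₁.mappingCone hQ S.f) hZ)),
      (boundedAcyclic C).leftOrthogonal.le_shift 1 _ hP⟩

end HomotopyCategory

/-! ### Serre duality for bounded acyclic complexes -/

namespace CategoryTheory

section

variable {R : Type w} [CommRing R] {E : Type v} [AddCommGroup E] [Module R E]
variable {C : Type u} [Category.{v} C] [Preadditive C] [Linear R C] (P : ObjectProperty C)

/-- The `R`-linear equivalence between morphisms in a full subcategory and in the category. -/
def ObjectProperty.homLinearEquiv (X Y : P.FullSubcategory) : (X ⟶ Y) ≃ₗ[R] (X.obj ⟶ Y.obj) :=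
  InducedCategory.homLinearEquiv (F := ObjectProperty.FullSubcategory.obj)

lemma ObjectProperty.homLinearEquiv_apply {X Y : P.FullSubcategory} (f : X ⟶ Y) :
    P.homLinearEquiv (R := R) X Y f = f.hom := rfl

variable {P}

theorem IsRightNakayamaPair.exists_fullSubcategory_of_left (X : P.FullSubcategory) {V : C}
    {φ : (X.obj ⟶ V) →ₗ[R] E} (hφ : IsRightNakayamaPair φ) (V' : P.FullSubcategory)
    (j : V'.obj ⟶ V)
    (hj : ∀ U : C, P U → Function.Bijective (fun f : U ⟶ V'.obj => f ≫ j)) :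
    ∃ φ' : (X ⟶ V') →ₗ[R] E, IsRightNakayamaPair φ' := by
  refine ⟨φ ∘ₗ Linear.rightComp R X.obj j ∘ₗ (P.homLinearEquiv X V').toLinearMap, ?_, ?_⟩
  · intro U ψ
    obtain ⟨g, hg⟩ := hφ.exists_right (ψ ∘ₗ (P.homLinearEquiv X U).symm.toLinearMap)
    obtain ⟨g, rfl⟩ := (hj U.obj U.property).2 g
    refine ⟨P.homMk g, fun f => ?_⟩
    have h := hg (P.homLinearEquiv (R := R) X U f)
    rw [LinearMap.comp_apply, LinearEquiv.coe_coe, LinearEquiv.symm_apply_apply] at h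
    exact h.trans (by simp [ObjectProperty.homLinearEquiv_apply])
  · intro U g hg
    apply P.hom_ext
    apply (hj U.obj U.property).1
    dsimp only
    erw [zero_comp]
    refine hφ.right_eq_zero _ fun f => ?_
    simpa [ObjectProperty.homLinearEquiv_apply] using hg (P.homMk f)

theorem IsRightNakayamaPair.exists_fullSubcategory_of_right (V : P.FullSubcategory) {X : C}
    {φ : (X ⟶ V.obj) →ₗ[R] E} (hφ : IsRightNakayamaPair φ) (X' : P.FullSubcategory)
    (c : X ⟶ X'.obj)
    (hc : ∀ U : C, P U → Function.Bijective (fun f : X'.obj ⟶ U => c ≫ f)) :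
    ∃ φ' : (X' ⟶ V) →ₗ[R] E, IsRightNakayamaPair φ' := by
  refine ⟨φ ∘ₗ Linear.leftComp R V.obj c ∘ₗ (P.homLinearEquiv X' V).toLinearMap, ?_, ?_⟩
  · intro U ψ
    let L : (X' ⟶ U) ≃ₗ[R] (X ⟶ U.obj) := (P.homLinearEquiv X' U).trans
      (LinearEquiv.ofBijective (Linear.leftComp R U.obj c) (hc U.obj U.property))
    obtain ⟨g, hg⟩ := hφ.exists_right (ψ ∘ₗ L.symm.toLinearMap)
    refine ⟨P.homMk g, fun f => ?_⟩
    have h := hg (L f)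
    rw [LinearMap.comp_apply, LinearEquiv.coe_coe, LinearEquiv.symm_apply_apply] at h
    refine h.trans (congr_arg φ ?_)
    exact (Category.assoc c f.hom g)
  · intro U g hg
    apply P.hom_ext
    refine hφ.right_eq_zero _ fun f => ?_
    obtain ⟨f, rfl⟩ := (hc U.obj U.property).2 f
    simpa [ObjectProperty.homLinearEquiv_apply] using hg (P.homMk f)

end

section

variable {C : Type u} [Category.{v} C] [Abelian C]

theorem hasInjectiveDimensionLT_of_forall_hasProjectiveDimensionLT (n : ℕ)
    (h : ∀ X : C, HasProjectiveDimensionLT X n) (X : C) : HasInjectiveDimensionLT X n := by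
  let := HasExt.standard C
  exact HasInjectiveDimensionLT.mk fun i hi Y e => e.eq_zero_of_hasProjectiveDimensionLT n hi

end

end CategoryTheory

namespace CochainComplex

variable {R : Type w} [CommRing R] [IsNoetherianRing R]
variable {C : Type u} [Category.{v} C] [Abelian C] [Linear R C]

theorem IsFinitelySupported.finite_hom {K L : CochainComplex C ℤ} (hK : K.IsFinitelySupported)
    (h : ∀ X Y : C, Module.Finite R (X ⟶ Y)) : Module.Finite R (K ⟶ L) := by
  obtain ⟨s, hs⟩ := hK
  let F : (K ⟶ L) →ₗ[R] (∀ i : s, K.X i ⟶ L.X i) :=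
    { toFun := fun f i => f.f i
      map_add' := fun _ _ => rfl
      map_smul' := fun _ _ => rfl }
  refine Module.Finite.of_injective F fun f g hfg => ?_
  ext i
  by_cases hi : i ∈ s
  · exact congr_fun hfg ⟨i, hi⟩
  · exact (hs i hi).eq_of_src _ _

end CochainComplex

namespace HomotopyCategory

open CochainComplex

theorem finite_hom_of_bounded {R : Type w} [CommRing R] [IsNoetherianRing R]
    {C : Type u} [Category.{v} C] [Abelian C] [Linear R C]
    (h : ∀ X Y : C, Module.Finite R (X ⟶ Y))
    (X Y : HomotopyCategory C (ComplexShape.up ℤ)) (hX : bounded C X) :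
    Module.Finite R (X ⟶ Y) := by
  obtain ⟨X, rfl⟩ := HomotopyCategory.quotient_obj_surjective X
  obtain ⟨Y, rfl⟩ := HomotopyCategory.quotient_obj_surjective Y
  have := IsFinitelySupported.finite_hom (L := Y)
    ((bounded_iff_isFinitelySupported X).1 hX) h
  exact Module.Finite.of_surjective ((quotient C (ComplexShape.up ℤ)).mapLinearMap R)
    (quotient C (ComplexShape.up ℤ)).map_surjective

theorem isHomFinite_boundedAcyclic {R : Type w} [CommRing R] [IsNoetherianRing R]
    {C : Type u} [Category.{v} C] [Abelian C] [Linear R C]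
    (h : ∀ X Y : C, Module.Finite R (X ⟶ Y)) : IsHomFinite R (BoundedAcyclic C) := fun X Y =>
  have := finite_hom_of_bounded h X.obj Y.obj X.property.1
  Module.Finite.equiv ((boundedAcyclic C).homLinearEquiv X Y).symm

variable {R : Type v} [CommRing R] [IsNoetherianRing R] {E : Type v} [AddCommGroup E] [Module R E]
variable {C : Type u} [Category.{v} C] [Abelian C] [Linear R C]

theorem BoundedAcyclic.exists_isNakayamaPair_of_left (hE : IsMatlisModule R E)
    (hC : HasEnoughNakayamaPairs R E C) (h : ∀ X Y : C, Module.Finite R (X ⟶ Y)) (n : ℕ)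
    (hn : ∀ X : C, HasProjectiveDimensionLT X (n + 1)) (X : BoundedAcyclic C) :
    ∃ (V : BoundedAcyclic C) (φ : (X ⟶ V) →ₗ[R] E), IsNakayamaPair φ := by
  obtain ⟨V, φ, hV, hφ⟩ := exists_isRightNakayamaPair_of_left hE hC X.obj X.property.1
  obtain ⟨V, rfl⟩ := HomotopyCategory.quotient_obj_surjective V
  obtain ⟨I, s, hs, hI⟩ := exists_trW_rightOrthogonal hE hC n V
    ((bounded_iff_isFinitelySupported V).1 hV)
    (fun i => hasInjectiveDimensionLT_of_forall_hasProjectiveDimensionLT _ hn _)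
  rw [ObjectProperty.trW_iff'] at hs
  obtain ⟨V', j, d, hT, hV'⟩ := hs
  obtain ⟨φ', hφ'⟩ := hφ.exists_fullSubcategory_of_left X ⟨V', hV'⟩ j (fun U hU => by
    have h : (boundedAcyclic C).rightOrthogonal.leftOrthogonal U := fun I f hI => hI f hU
    rw [← ObjectProperty.isColocal_trW] at h
    exact h j (ObjectProperty.trW.mk _ hT hI))
  exact ⟨_, φ', hφ'.isNakayamaPair hE (isHomFinite_boundedAcyclic h _)⟩

theorem BoundedAcyclic.exists_isNakayamaPair_of_right (hE : IsMatlisModule R E)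
    (hC : HasEnoughNakayamaPairs R E C) (h : ∀ X Y : C, Module.Finite R (X ⟶ Y)) (n : ℕ)
    (hn : ∀ X : C, HasProjectiveDimensionLT X (n + 1)) (V : BoundedAcyclic C) :
    ∃ (X : BoundedAcyclic C) (φ : (X ⟶ V) →ₗ[R] E), IsNakayamaPair φ := by
  obtain ⟨X, φ, hX, hφ⟩ := exists_isRightNakayamaPair_of_right hE hC V.obj V.property.1
  obtain ⟨X, rfl⟩ := HomotopyCategory.quotient_obj_surjective X
  obtain ⟨P, s, hs, hP⟩ := exists_trW_leftOrthogonal hE hC n X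
    ((bounded_iff_isFinitelySupported X).1 hX) (fun i => hn _)
  obtain ⟨X', c, d, hT, hX'⟩ := hs
  obtain ⟨φ', hφ'⟩ := hφ.exists_fullSubcategory_of_right V ⟨X', hX'⟩ c (fun U hU => by
    have h : (boundedAcyclic C).leftOrthogonal.rightOrthogonal U := fun I f hI => hI f hU
    rw [← ObjectProperty.isLocal_trW] at h
    exact h c (ObjectProperty.trW.mk' _ hT hP))
  exact ⟨_, φ', hφ'.isNakayamaPair hE (isHomFinite_boundedAcyclic h _)⟩

end HomotopyCategory

/-! ### Krull-Schmidt categories -/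

theorem IsArtinianRing.isUnit_or_isUnit_one_sub_self_of_isIdempotentElem {S : Type*} [CommRing S]
    [IsArtinianRing S] (h : ∀ e : S, IsIdempotentElem e → e = 0 ∨ e = 1) (a : S) :
    IsUnit a ∨ IsUnit (1 - a) := by
  obtain ⟨n, y, hy⟩ := IsArtinian.exists_pow_succ_smul_dvd (M := S) a 1
  replace hy : a ^ n * (a * y) = a ^ n := by
    simpa [pow_succ, mul_assoc] using hy
  have hk (k : ℕ) : a ^ n * (a * y) ^ k = a ^ n := by
    induction k with
    | zero => simp
    | succ k ih => rw [pow_succ, ← mul_assoc, ih, hy]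
  have he : IsIdempotentElem ((a * y) ^ n) := by
    rw [IsIdempotentElem]
    calc (a * y) ^ n * (a * y) ^ n = y ^ n * (a ^ n * (a * y) ^ n) := by ring
      _ = (a * y) ^ n := by rw [hk]; ring
  obtain h0 | h1 := h _ he
  · right
    have := hk n
    rw [h0, mul_zero] at this
    exact IsNilpotent.isUnit_one_sub ⟨n, this.symm⟩
  · left
    refine IsUnit.of_mul_eq_one (y * (a * y) ^ (n - 1)) ?_
    rcases n with _ | n
    · simpa using hy
    · rw [← mul_assoc, Nat.add_sub_cancel, mul_comm, ← pow_succ, h1]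

theorem IsLocalRing.of_forall_isIdempotentElem (R : Type*) {A : Type*} [CommRing R]
    [IsArtinianRing R] [Ring A] [Algebra R A] [Module.Finite R A] [Nontrivial A]
    (h : ∀ e : A, IsIdempotentElem e → e = 0 ∨ e = 1) : IsLocalRing A := by
  refine IsLocalRing.of_isUnit_or_isUnit_one_sub_self fun a => ?_
  let S := Algebra.adjoin R {a}
  let _ : CommRing S := 
    { mul_comm := (Algebra.isMulCommutative_adjoin R (by simp)).is_comm.comm }
  have : Module.Finite R S := inferInstanceAs (Module.Finite R S.toSubmodule)
  have : IsArtinianRing S := IsArtinianRing.of_finite R S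
  have hS : ∀ e : S, IsIdempotentElem e → e = 0 ∨ e = 1 := fun e he => by
    have := h e.1 (congr_arg Subtype.val he)
    exact this.imp (fun h => Subtype.ext h) (fun h => Subtype.ext h)
  let a' : S := ⟨a, Algebra.self_mem_adjoin_singleton R a⟩
  exact (IsArtinianRing.isUnit_or_isUnit_one_sub_self_of_isIdempotentElem hS a').imp
    (fun h => h.map S.val) (fun h => h.map S.val)

theorem IsLocalRing.of_surjective_of_nontrivial {A B : Type*} [Ring A] [Ring B] [IsLocalRing A]
    [Nontrivial B] (f : A →+* B) (hf : Function.Surjective f) : IsLocalRing B :=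
  IsLocalRing.of_isUnit_or_isUnit_one_sub_self fun b => by
    obtain ⟨a, rfl⟩ := hf b
    have h : a + (1 - a) = 1 := by abel
    exact (IsLocalRing.isUnit_or_isUnit_of_add_one h).imp (fun h => h.map f)
      (fun h => by simpa using h.map f)

theorem IsLocalRing.eq_zero_or_eq_one_of_isIdempotentElem {A : Type*} [Ring A] [IsLocalRing A]
    {e : A} (he : IsIdempotentElem e) : e = 0 ∨ e = 1 := by
  have h : e + (1 - e) = 1 := by abel
  rcases IsLocalRing.isUnit_or_isUnit_of_add_one h with h | h
  · right
    exact h.mul_left_cancel (by rw [he.eq, mul_one])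
  · left
    exact h.mul_left_cancel (by rw [sub_mul, he.eq, one_mul, sub_self, mul_zero])

namespace CategoryTheory

/-- The ring homomorphism between endomorphism rings induced by an additive functor. -/
@[simps]
def Functor.mapEndRingHom {C D : Type*} [Category* C] [Category* D] [Preadditive C]
    [Preadditive D] (G : C ⥤ D) [G.Additive] (X : C) : End X →+* End (G.obj X) where
  toFun f := G.map f
  map_one' := G.map_id X
  map_mul' f g := G.map_comp g f
  map_zero' := G.map_zero X X
  map_add' _ _ := G.map_add

section

variable {T : Type u} [Category.{v} T] [Preadditive T] [HasFiniteBiproducts T]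

theorem exists_fin_iso_biproduct {X : T} {J : Type} [Finite J] (F : J → T)
    (hF : ∀ j, IsLocalRing (End (F j))) (e : X ≅ ⨁ F) :
    ∃ (n : ℕ) (F : Fin n → T), (∀ i, IsLocalRing (End (F i))) ∧ Nonempty (X ≅ ⨁ F) := by
  obtain ⟨n, ⟨σ⟩⟩ := Finite.exists_equiv_fin J
  exact ⟨n, fun i => F (σ.symm i), fun i => hF _,
    ⟨e ≪≫ biproduct.whiskerEquiv σ (fun j => eqToIso (by simp))⟩⟩

/-- A finite biproduct indexed by a sum type is the biproduct of two finite biproducts. -/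
noncomputable def biprodBiproductIso {J₁ J₂ : Type} [Finite J₁] [Finite J₂] (F : J₁ ⊕ J₂ → T)
    [HasBinaryBiproduct (⨁ fun j => F (Sum.inl j)) (⨁ fun j => F (Sum.inr j))] :
    (⨁ fun j => F (Sum.inl j)) ⊞ (⨁ fun j => F (Sum.inr j)) ≅ ⨁ F where
  hom := biprod.desc (biproduct.desc fun j => biproduct.ι F (Sum.inl j))
    (biproduct.desc fun j => biproduct.ι F (Sum.inr j))
  inv := biproduct.desc (fun j => match j with
    | Sum.inl j => biproduct.ι (fun j => F (Sum.inl j)) j ≫ biprod.inl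
    | Sum.inr j => biproduct.ι (fun j => F (Sum.inr j)) j ≫ biprod.inr)
  hom_inv_id := by
    apply biprod.hom_ext' <;> apply biproduct.hom_ext' <;> intro j <;> simp
  inv_hom_id := by
    apply biproduct.hom_ext'
    rintro (j | j) <;> simp

variable {R : Type w} [CommRing R] [IsArtinianRing R] {D : Type u'} [Category.{v} D]
  [Preadditive D] [Linear R D] [IsIdempotentComplete D]

theorem exists_biproduct_of_full (hD : ∀ X : D, Module.Finite R (X ⟶ X)) (G : D ⥤ T)
    [G.Additive] [G.Full] (l : ℕ∞) : ∀ X : D, Module.length R (X ⟶ X) = l →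
      ∃ (J : Type) (_ : Finite J) (F : J → T),
        (∀ i, IsLocalRing (End (F i))) ∧ Nonempty (G.obj X ≅ ⨁ F) := by
  induction l using WellFoundedLT.induction with
  | ind l ih =>
    intro X hl
    by_cases h0 : IsZero (G.obj X)
    · exact ⟨Empty, inferInstance, Empty.elim, fun i => i.elim,
        ⟨h0.iso ((IsZero.iff_id_eq_zero _).2 (biproduct.hom_ext _ _ fun i => i.elim))⟩⟩
    by_cases h : ∀ e : X ⟶ X, e ≫ e = e → e = 0 ∨ e = 𝟙 X
    · have : Module.Finite R (End X) := hD X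
      have : Nontrivial (End (G.obj X)) := ⟨1, 0, fun h => h0 ((IsZero.iff_id_eq_zero _).2 h)⟩
      have : Nontrivial (End X) := (G.mapEndRingHom X).domain_nontrivial
      have : IsLocalRing (End X) := IsLocalRing.of_forall_isIdempotentElem R fun e he => h e he
      have : IsLocalRing (End (G.obj X)) :=
        IsLocalRing.of_surjective_of_nontrivial (G.mapEndRingHom X) G.map_surjective
      exact ⟨Unit, inferInstance, fun _ => G.obj X, fun _ => this,
        ⟨(biproductUniqueIso (fun _ : Unit => G.obj X)).symm⟩⟩
    · push Not at h
      obtain ⟨e, he, he0, he1⟩ := h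
      obtain ⟨Y, i, p, hip, hpi⟩ := IsIdempotentComplete.idempotents_split X e he
      obtain ⟨Z, j, q, hjq, hqj⟩ := IsIdempotentComplete.idempotents_split X (𝟙 X - e)
        (by simp [he])
      have hiq : i ≫ q = 0 := by
        have : i ≫ (q ≫ j) ≫ q = 0 := by
          rw [hqj, ← hpi, Preadditive.sub_comp, Preadditive.comp_sub, Category.id_comp,
            Category.assoc, reassoc_of% hip, sub_self]
        simpa [hjq] using this
      have hjp : j ≫ p = 0 := by
        have : j ≫ (p ≫ i) ≫ p = 0 := by
          have h : p ≫ i = 𝟙 X - q ≫ j := by rw [hqj, hpi, sub_sub_cancel]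
          rw [h, Preadditive.sub_comp, Preadditive.comp_sub, Category.id_comp,
            Category.assoc, reassoc_of% hjq, sub_self]
        simpa [hip] using this
      let L : (Y ⟶ Y) × (Z ⟶ Z) →ₗ[R] (X ⟶ X) :=
        (Linear.leftComp R X p ∘ₗ Linear.rightComp R Y i).coprod
          (Linear.leftComp R X q ∘ₗ Linear.rightComp R Z j)
      have hL : Function.Injective L := by
        rintro ⟨f, g⟩ ⟨f', g'⟩ h
        replace h : p ≫ f ≫ i + q ≫ g ≫ j = p ≫ f' ≫ i + q ≫ g' ≫ j := h
        have h₁ := congr_arg (fun t => i ≫ t ≫ p) h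
        have h₂ := congr_arg (fun t => j ≫ t ≫ q) h
        simp only [Preadditive.add_comp, Category.assoc, hip, hjp, hiq, hjq,
          reassoc_of% hip, reassoc_of% hjq, Category.comp_id, comp_zero, zero_add, add_zero] at h₁ h₂
        rw [h₁, h₂]
      have hY0 : Nontrivial (Y ⟶ Y) := ⟨𝟙 Y, 0, fun h => he0 (by
        rw [← hpi, ← Category.id_comp i, h, zero_comp, comp_zero])⟩
      have hZ0 : Nontrivial (Z ⟶ Z) := ⟨𝟙 Z, 0, fun h => he1 (by
        rw [← Category.id_comp j, h, zero_comp, comp_zero] at hqj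
        exact (sub_eq_zero.1 hqj.symm).symm)⟩
      have := hD X
      have := hD Y
      have := hD Z
      have hle := Module.length_le_of_injective L hL
      rw [Module.length_prod, hl] at hle
      obtain ⟨J₁, _, F₁, hF₁, ⟨e₁⟩⟩ := ih _ ((ENat.lt_add_left (Module.length_ne_top (R := R))
        (Module.length_pos (R := R) (M := Z ⟶ Z))).trans_le ((add_comm _ _).trans_le hle)) Y rfl
      obtain ⟨J₂, _, F₂, hF₂, ⟨e₂⟩⟩ := ih _ ((ENat.lt_add_left (Module.length_ne_top (R := R))
        (Module.length_pos (R := R) (M := Y ⟶ Y))).trans_le hle) Z rfl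
      have := HasBinaryBiproducts.of_hasBinaryProducts (C := T)
      let e₀ : G.obj X ≅ G.obj Y ⊞ G.obj Z :=
        { hom := biprod.lift (G.map p) (G.map q)
          inv := biprod.desc (G.map i) (G.map j)
          hom_inv_id := by
            rw [biprod.lift_desc, ← G.map_comp, ← G.map_comp, ← G.map_add, hpi, hqj,
              add_sub_cancel, G.map_id]
          inv_hom_id := by
            apply biprod.hom_ext' <;> apply biprod.hom_ext <;>
              simp [← G.map_comp, hip, hjp, hiq, hjq] }
      refine ⟨J₁ ⊕ J₂, inferInstance, Sum.elim F₁ F₂, ?_,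
        ⟨e₀ ≪≫ biprod.mapIso e₁ e₂ ≪≫ biprodBiproductIso (Sum.elim F₁ F₂)⟩⟩
      rintro (j | j)
      · exact hF₁ j
      · exact hF₂ j

theorem isKrullSchmidt_of_full (hD : ∀ X : D, Module.Finite R (X ⟶ X)) (G : D ⥤ T)
    [G.Additive] [G.Full] (hG : ∀ X : T, ∃ Y : D, Nonempty (G.obj Y ≅ X)) : IsKrullSchmidt T := by
  intro X
  obtain ⟨Y, ⟨e⟩⟩ := hG X
  obtain ⟨J, _, F, hF, ⟨e'⟩⟩ := exists_biproduct_of_full hD G _ Y rfl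
  exact exists_fin_iso_biproduct F hF (e.symm ≪≫ e')

end

instance {D : Type u} [Category.{v} D] [IsIdempotentComplete D] (P : ObjectProperty D)
    [P.IsStableUnderRetracts] : IsIdempotentComplete P.FullSubcategory where
  idempotents_split X p hp := by
    obtain ⟨Y, i, e, hie, hei⟩ := IsIdempotentComplete.idempotents_split X.obj p.hom
      (congr_arg (fun f => f.hom) hp)
    exact ⟨⟨Y, P.prop_of_retract ⟨i, e, hie⟩ X.property⟩, P.homMk i, P.homMk e,
      P.hom_ext hie, P.hom_ext hei⟩

end CategoryTheory

namespace HomotopyCategory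

open CochainComplex

variable {C : Type u} [Category.{v} C] [Abelian C]

instance : ((boundedAcyclic C).inverseImage
    (quotient C (ComplexShape.up ℤ))).IsStableUnderRetracts where
  of_retract {K L} r hL := by
    have : Mono r.i := inferInstance
    refine ⟨(bounded_iff_isFinitelySupported K).2
      (IsFinitelySupported.of_mono ((bounded_iff_isFinitelySupported L).1 hL.1) r.i), ?_⟩
    refine (mem_subcategoryAcyclic_iff _).2 fun n => ?_
    have h := (mem_subcategoryAcyclic_iff _).1 hL.2 n
    have hr := r.map (quotient C (ComplexShape.up ℤ) ⋙ homologyFunctor C (ComplexShape.up ℤ) n)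
    exact IsZero.of_mono hr.i h

theorem isKrullSchmidt_boundedAcyclic {R : Type w} [CommRing R] [IsArtinianRing R]
    [Linear R C] [HasFiniteBiproducts (BoundedAcyclic C)]
    (h : ∀ X Y : C, Module.Finite R (X ⟶ Y)) : IsKrullSchmidt (BoundedAcyclic C) := by
  let P := (boundedAcyclic C).inverseImage (quotient C (ComplexShape.up ℤ))
  let G : P.FullSubcategory ⥤ BoundedAcyclic C :=
    (boundedAcyclic C).lift (P.ι ⋙ quotient C (ComplexShape.up ℤ)) (fun X => X.property)
  have : (P.ι ⋙ quotient C (ComplexShape.up ℤ)).Full := inferInstance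
  have : G.Full := Functor.Full.of_comp_faithful_iso
    ((boundedAcyclic C).liftCompιIso (P.ι ⋙ quotient C (ComplexShape.up ℤ)) fun X => X.property)
  have : G.Additive := ⟨fun {X Y f g} => (boundedAcyclic C).hom_ext
    (quotient C (ComplexShape.up ℤ)).map_add⟩
  refine isKrullSchmidt_of_full (R := R) (fun X => ?_) G (fun X => ?_)
  · have := IsFinitelySupported.finite_hom (L := X.obj)
      ((bounded_iff_isFinitelySupported X.obj).1 X.property.1) h
    exact Module.Finite.equiv (P.homLinearEquiv X X).symm
  · obtain ⟨Y, hY⟩ := HomotopyCategory.quotient_obj_surjective X.obj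
    exact ⟨⟨Y, by
        change boundedAcyclic C ((quotient C (ComplexShape.up ℤ)).obj Y)
        rw [hY]
        exact X.property⟩,
      ⟨(boundedAcyclic C).isoMk (eqToIso hY)⟩⟩

end HomotopyCategory

/-! ### Auslander-Reiten triangles -/

theorem IsLocalRing.exists_linearMap_eq_zero_of_not_isUnit {R : Type v} [CommRing R] {E : Type v}
    [AddCommGroup E] [Module R E] (hE : IsMatlisModule R E) (A : Type v) [Ring A] [Algebra R A]
    [IsLocalRing A] : ∃ ψ : A →ₗ[R] E, ψ 1 ≠ 0 ∧ ∀ a, ¬ IsUnit a → ψ a = 0 := by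
  let N : Submodule R A :=
    { carrier := {a | ¬ IsUnit a}
      zero_mem' := not_isUnit_zero
      add_mem' := by
        rintro a b ha hb ⟨u, hu⟩
        have h : a * ↑u⁻¹ + b * ↑u⁻¹ = 1 := by rw [← add_mul, ← hu, Units.mul_inv]
        rcases IsLocalRing.isUnit_or_isUnit_of_add_one h with h | h
        · exact ha (by simpa using h)
        · exact hb (by simpa using h)
      smul_mem' := by
        rintro r a ha ⟨u, hu⟩
        exact ha ⟨⟨a, r • ↑u⁻¹, by rw [mul_smul_comm, ← smul_mul_assoc, ← hu, Units.mul_inv],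
          by rw [smul_mul_assoc, ← mul_smul_comm, ← hu, Units.inv_mul]⟩, rfl⟩ }
  obtain ⟨ψ, hψ⟩ := hE.exists_ne_zero (A ⧸ N) (N.mkQ 1) (fun h =>
    ((Submodule.Quotient.mk_eq_zero N).1 h : ¬ IsUnit (1 : A)) isUnit_one)
  exact ⟨ψ ∘ₗ N.mkQ, hψ, fun a ha => by
    rw [LinearMap.comp_apply, Submodule.mkQ_apply, (Submodule.Quotient.mk_eq_zero N).2 ha,
      map_zero]⟩

namespace CategoryTheory

section

variable {T : Type u} [Category.{v} T] [Preadditive T]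

theorem indecomposable_of_isLocalRing_end [HasBinaryBiproducts T] (X : T)
    [IsLocalRing (End X)] : Indecomposable X := by
  refine ⟨fun h => zero_ne_one (α := End X) (h.eq_of_src _ _), fun Y Z e => ?_⟩
  have h : IsIdempotentElem (M := End X) (e.hom ≫ biprod.fst ≫ biprod.inl ≫ e.inv) := by
    change (_ ≫ _ : X ⟶ X) = _
    simp
  rcases IsLocalRing.eq_zero_or_eq_one_of_isIdempotentElem h with h | h
  · left
    rw [IsZero.iff_id_eq_zero]
    have h' := congr_arg (fun t => biprod.inl ≫ e.inv ≫ t ≫ e.hom ≫ biprod.fst) h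
    change biprod.inl ≫ e.inv ≫ (e.hom ≫ biprod.fst ≫ biprod.inl ≫ e.inv) ≫ e.hom ≫ biprod.fst
      = biprod.inl ≫ e.inv ≫ (0 : X ⟶ X) ≫ e.hom ≫ biprod.fst at h'
    simpa using h'
  · right
    rw [IsZero.iff_id_eq_zero]
    have h' := congr_arg (fun t => biprod.inr ≫ e.inv ≫ t ≫ e.hom ≫ biprod.snd) h
    change biprod.inr ≫ e.inv ≫ (e.hom ≫ biprod.fst ≫ biprod.inl ≫ e.inv) ≫ e.hom ≫ biprod.snd
      = biprod.inr ≫ e.inv ≫ 𝟙 X ≫ e.hom ≫ biprod.snd at h'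
    simpa using h'.symm

theorem IsLocalRing.end_of_full_of_faithful {D : Type*} [Category* D] [Preadditive D] (G : T ⥤ D)
    [G.Additive] [G.Full] [G.Faithful] (X : T) [IsLocalRing (End X)] :
    IsLocalRing (End (G.obj X)) := by
  have : Nontrivial (End (G.obj X)) := ⟨1, 0, fun h => one_ne_zero (α := End X)
    (G.map_injective ((G.map_id X).trans (h.trans (G.map_zero X X).symm)))⟩
  exact IsLocalRing.of_surjective_of_nontrivial (G.mapEndRingHom X) G.map_surjective

theorem IsLocalRing.end_of_iso {X Y : T} (e : X ≅ Y) [IsLocalRing (End X)] :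
    IsLocalRing (End Y) := by
  let f : End X →+* End Y :=
    { toFun := fun t => e.inv ≫ t ≫ e.hom
      map_one' := by simp [End.one_def]
      map_mul' := fun a b => by simp [End.mul_def]
      map_zero' := (congr_arg (e.inv ≫ ·) zero_comp).trans comp_zero
      map_add' := fun a b => (congr_arg (e.inv ≫ ·) (Preadditive.add_comp _ _ _ _ _ _)).trans
        (Preadditive.comp_add _ _ _ _ _ _) }
  have : Nontrivial (End Y) := ⟨1, 0, fun h => one_ne_zero (α := End X) (by
    have h' := congr_arg (fun t => e.hom ≫ t ≫ e.inv) h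
    change e.hom ≫ 𝟙 Y ≫ e.inv = e.hom ≫ (0 : Y ⟶ Y) ≫ e.inv at h'
    simpa using h')⟩
  exact IsLocalRing.of_surjective_of_nontrivial f fun t => ⟨e.hom ≫ t ≫ e.inv, by simp [f]⟩

theorem IsKrullSchmidt.isLocalRing_end [HasFiniteBiproducts T] [HasBinaryBiproducts T]
    (hT : IsKrullSchmidt T) {X : T} (hX : Indecomposable X) : IsLocalRing (End X) := by
  obtain ⟨n, F, hF, ⟨e⟩⟩ := hT X
  obtain _ | n := n
  · exact (hX.1 ((IsZero.iff_id_eq_zero _).2 (by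
      rw [← e.hom_inv_id, ← Category.id_comp e.inv,
        biproduct.hom_ext (𝟙 (⨁ F)) 0 (fun i => i.elim0), zero_comp, comp_zero]))).elim
  · let σ : Unit ⊕ Fin n ≃ Fin (n + 1) := Fintype.equivOfCardEq (by simp [add_comm])
    let e' : X ≅ (⨁ fun j : Unit => F (σ (Sum.inl j))) ⊞ (⨁ fun j => F (σ (Sum.inr j))) :=
      e ≪≫ (biproduct.whiskerEquiv σ fun j => Iso.refl (F (σ j))).symm ≪≫
        (biprodBiproductIso fun j => F (σ j)).symm
    let e₁ : (⨁ fun j : Unit => F (σ (Sum.inl j))) ≅ F (σ (Sum.inl ())) :=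
      biproductUniqueIso (fun j : Unit => F (σ (Sum.inl j)))
    have := hF (σ (Sum.inl ()))
    rcases hX.2 _ _ e' with h | h
    · exact (zero_ne_one (α := End (F (σ (Sum.inl ())))) ((h.of_iso e₁.symm).eq_of_src _ _)).elim
    · have : IsIso (biprod.fst : (⨁ fun j : Unit => F (σ (Sum.inl j))) ⊞
          (⨁ fun j => F (σ (Sum.inr j))) ⟶ _) :=
        ⟨biprod.inl, biprod.hom_ext' _ _ (by simp) (h.eq_of_src _ _), by simp⟩
      exact IsLocalRing.end_of_iso (e' ≪≫ asIso biprod.fst ≪≫ e₁).symm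

theorem isIso_of_isUnit_comp {W Z : T} [IsLocalRing (End W)] [Nontrivial (End Z)] (s : Z ⟶ W)
    (t : W ⟶ Z) (h : IsUnit (M := End Z) (s ≫ t)) : IsIso t := by
  have : IsIso (s ≫ t) := (isUnit_iff_isIso _).1 h
  let s' := inv (s ≫ t) ≫ s
  have hs' : s' ≫ t = 𝟙 Z := by simp [s']
  have he : IsIdempotentElem (M := End W) (t ≫ s') := by
    change (t ≫ s') ≫ t ≫ s' = _
    rw [Category.assoc, reassoc_of% hs']
  rcases IsLocalRing.eq_zero_or_eq_one_of_isIdempotentElem he with h | h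
  · exfalso
    refine one_ne_zero (α := End Z) ?_
    change 𝟙 Z = 0
    replace h : t ≫ s' = 0 := h
    rw [← Category.id_comp (𝟙 Z), ← hs', Category.assoc, reassoc_of% h, zero_comp, comp_zero]
  · exact ⟨s', h, hs'⟩

variable {R : Type v} [CommRing R] {E : Type v} [AddCommGroup E] [Module R E] [Linear R T]

theorem IsNakayamaPair.isLocalRing_end [IsArtinianRing R] {P I : T} {φ : (P ⟶ I) →ₗ[R] E}
    (hφ : IsNakayamaPair φ) (hP : Module.Finite R (P ⟶ P)) [IsLocalRing (End I)] :
    IsLocalRing (End P) := by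
  have : Module.Finite R (End P) := hP
  have : Nontrivial (End P) := ⟨1, 0, fun h => one_ne_zero (α := End I)
    (hφ.right_eq_zero (𝟙 I) fun f => by
      replace h : 𝟙 P = 0 := h
      rw [← Category.id_comp f, h, zero_comp, zero_comp, map_zero])⟩
  suffices ∀ e : P ⟶ P, e ≫ e = e → e = 0 ∨ e = 𝟙 P from
    IsLocalRing.of_forall_isIdempotentElem R this
  intro e he
  obtain ⟨r, hr⟩ := hφ.exists_right (φ ∘ₗ Linear.leftComp R I e)
  replace hr : ∀ f : P ⟶ I, φ (e ≫ f) = φ (f ≫ r) := hr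
  have hr' : IsIdempotentElem (M := End I) r := by
    refine sub_eq_zero.1 (hφ.right_eq_zero (r ≫ r - r) fun f => ?_)
    rw [Preadditive.comp_sub, map_sub, ← Category.assoc, ← hr, ← hr, ← Category.assoc,
      ← hr, ← Category.assoc, he, sub_self]
  rcases IsLocalRing.eq_zero_or_eq_one_of_isIdempotentElem hr' with h | h
  · left
    replace h : r = 0 := h
    exact hφ.left_eq_zero e fun g => by rw [hr, h, comp_zero, map_zero]
  · right
    replace h : r = 𝟙 I := h
    exact sub_eq_zero.1 (hφ.left_eq_zero (e - 𝟙 P) fun g => by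
      rw [Preadditive.sub_comp, map_sub, hr, h, Category.comp_id, Category.id_comp, sub_self])

theorem IsNakayamaPair.exists_almost_vanishing (hE : IsMatlisModule R E) {P I : T}
    {φ : (P ⟶ I) →ₗ[R] E} (hφ : IsNakayamaPair φ) [IsLocalRing (End P)] :
    ∃ h : P ⟶ I, h ≠ 0 ∧ ∀ (W : T) (_ : IsLocalRing (End W)) (t : W ⟶ P),
      ¬ IsIso t → t ≫ h = 0 := by
  obtain ⟨ψ, hψ₁, hψ⟩ := IsLocalRing.exists_linearMap_eq_zero_of_not_isUnit hE (End P)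
  obtain ⟨h, hh⟩ := hφ.exists_right ψ
  refine ⟨h, ?_, fun W _ t ht => hφ.right_eq_zero _ fun f => ?_⟩
  · rintro rfl
    exact hψ₁ ((hh (𝟙 P)).trans (by simp))
  · rw [← Category.assoc, ← hh]
    exact hψ _ fun h => ht (isIso_of_isUnit_comp f t h)

end

section

variable {T : Type u} [Category.{v} T] [Preadditive T] [HasZeroObject T] [HasShift T ℤ]
  [∀ n : ℤ, (shiftFunctor T n).Additive] [Pretriangulated T]
  {R : Type v} [CommRing R] [IsArtinianRing R] {E : Type v} [AddCommGroup E] [Module R E]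
  [Linear R T]

theorem isAuslanderReitenTriangle_of_forall_comp_eq_zero (hT : IsKrullSchmidt T) {X Y Z : T}
    [IsLocalRing (End X)] [IsLocalRing (End Z)] (f : X ⟶ Y) (g : Y ⟶ Z) (h : Z ⟶ X⟦(1 : ℤ)⟧)
    (dist : Triangle.mk f g h ∈ distTriang T) (hne : h ≠ 0)
    (hh : ∀ (W : T) (_ : IsLocalRing (End W)) (t : W ⟶ Z), ¬ IsIso t → t ≫ h = 0) :
    IsAuslanderReitenTriangle (Triangle.mk f g h) where
  distinguished := dist
  indecomposable₁ := indecomposable_of_isLocalRing_end X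
  indecomposable₃ := indecomposable_of_isLocalRing_end Z
  mor₃_ne_zero := hne
  factors W hW t ht := by
    obtain ⟨s, hs⟩ := Triangle.coyoneda_exact₃ _ dist t (hh W (hT.isLocalRing_end hW) t ht)
    exact ⟨s, hs.symm⟩

theorem hasAuslanderReitenTriangles_of_isNakayamaPair (hE : IsMatlisModule R E)
    (hT : IsKrullSchmidt T) (hR : IsHomFinite R T)
    (hl : ∀ X : T, ∃ (V : T) (φ : (X ⟶ V) →ₗ[R] E), IsNakayamaPair φ)
    (hr : ∀ V : T, ∃ (X : T) (φ : (X ⟶ V) →ₗ[R] E), IsNakayamaPair φ) :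
    HasAuslanderReitenTriangles T := by
  intro W hW
  have := hT.isLocalRing_end hW
  constructor
  · obtain ⟨Z, φ, hφ⟩ := hr (W⟦(1 : ℤ)⟧)
    have : IsLocalRing (End (W⟦(1 : ℤ)⟧)) :=
      IsLocalRing.end_of_full_of_faithful (shiftFunctor T (1 : ℤ)) W
    have := hφ.isLocalRing_end (hR Z Z)
    obtain ⟨h, hne, hh⟩ := hφ.exists_almost_vanishing hE
    obtain ⟨Y, f, g, dist⟩ := distinguished_cocone_triangle₂ h
    exact ⟨Y, Z, f, g, h, isAuslanderReitenTriangle_of_forall_comp_eq_zero hT f g h dist hne hh⟩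
  · obtain ⟨V, φ, hφ⟩ := hl W
    obtain ⟨h, hne, hh⟩ := hφ.exists_almost_vanishing hE
    obtain ⟨n, F, hF, ⟨e⟩⟩ := hT V
    obtain ⟨i, hi⟩ : ∃ i, h ≫ e.hom ≫ biproduct.π F i ≠ 0 := by
      by_contra! H
      refine hne ?_
      rw [← cancel_mono e.hom, zero_comp]
      exact biproduct.hom_ext _ _ fun i => by simpa using H i
    have := hF i
    have : IsLocalRing (End ((F i)⟦(-1 : ℤ)⟧)) :=
      IsLocalRing.end_of_full_of_faithful (shiftFunctor T (-1 : ℤ)) (F i)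
    let e' : ((F i)⟦(-1 : ℤ)⟧)⟦(1 : ℤ)⟧ ≅ F i := (shiftEquiv T (1 : ℤ)).counitIso.app (F i)
    let h' : W ⟶ ((F i)⟦(-1 : ℤ)⟧)⟦(1 : ℤ)⟧ := (h ≫ e.hom ≫ biproduct.π F i) ≫ e'.inv
    obtain ⟨Y, f, g, dist⟩ := distinguished_cocone_triangle₂ h'
    refine ⟨_, Y, f, g, h', isAuslanderReitenTriangle_of_forall_comp_eq_zero hT f g h' dist
      (fun H => hi ?_) fun W' hW' t ht => ?_⟩
    · rwa [← cancel_mono e'.inv, zero_comp]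
    · simp only [h', Category.assoc]
      rw [reassoc_of% hh W' hW' t ht, zero_comp]

end

end CategoryTheory

theorem HomotopyCategory.boundedAcyclic_fgModuleCat {R : Type u} [CommRing R] [IsArtinianRing R]
    {A : Type u} [Ring A] [Algebra R A] [Module.Finite R A] [IsNoetherianRing A]
    (hA : HasFiniteGlobalDimension A) :
    IsKrullSchmidt (BoundedAcyclic (FGModuleCat.{u} A)) ∧
      HasAuslanderReitenTriangles (BoundedAcyclic (FGModuleCat.{u} A)) := by
  obtain ⟨E, _, _, hE⟩ := exists_isMatlisModule R
  obtain ⟨n, hn⟩ := hA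
  have hC : HasEnoughNakayamaPairs R E (FGModuleCat.{u} A) := FGModuleCat.hasEnoughNakayamaPairs hE
  have h : ∀ X Y : FGModuleCat.{u} A, Module.Finite R (X ⟶ Y) := FGModuleCat.finite_hom
  have hdim : ∀ X : FGModuleCat.{u} A, HasProjectiveDimensionLT X (n + 1) := fun X =>
    FGModuleCat.hasProjectiveDimensionLT _ X (hn _)
  have hKS := isKrullSchmidt_boundedAcyclic h
  exact ⟨hKS, hasAuslanderReitenTriangles_of_isNakayamaPair hE hKS (isHomFinite_boundedAcyclic h)
    (BoundedAcyclic.exists_isNakayamaPair_of_left hE hC h n hdim)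
    (BoundedAcyclic.exists_isNakayamaPair_of_right hE hC h n hdim)⟩

theorem mainTheorem4 {R : Type w} [CommRing R] [IsArtinianRing R]
    {Λ : Type u} [Ring Λ] [Algebra R Λ] [Module.Finite R Λ]
    (hΛ : HasFiniteGlobalDimension Λᵐᵒᵖ) :
    -- right `Λ`-modules are the same as left `Λᵐᵒᵖ`-modules
    haveI : IsNoetherianRing Λᵐᵒᵖ := isNoetherianRing_mulOpposite_of_artinAlgebra R Λ
    IsHomFinite R (HomotopyCategory.BoundedAcyclic (FGModuleCat.{u} Λᵐᵒᵖ)) ∧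
      IsKrullSchmidt (HomotopyCategory.BoundedAcyclic (FGModuleCat.{u} Λᵐᵒᵖ)) ∧
      HasAuslanderReitenTriangles (HomotopyCategory.BoundedAcyclic (FGModuleCat.{u} Λᵐᵒᵖ)) := by
  have : IsNoetherianRing Λᵐᵒᵖ := isNoetherianRing_mulOpposite_of_artinAlgebra R Λ
  have : Module.Finite R Λᵐᵒᵖ := Module.Finite.equiv (MulOpposite.opLinearEquiv R)
  have : Module.Finite R (Subalgebra.center R Λᵐᵒᵖ) :=
    inferInstanceAs (Module.Finite R (Subalgebra.center R Λᵐᵒᵖ).toSubmodule)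
  have : IsArtinianRing (Subalgebra.center R Λᵐᵒᵖ) := IsArtinianRing.of_finite R _
  let : Algebra (Subalgebra.center R Λᵐᵒᵖ) Λᵐᵒᵖ := Algebra.ofModule
    (fun r x y => smul_mul_assoc r x y)
    (fun r x y => by
      have h := (Subalgebra.mem_center_iff.1 r.2 x)
      change x * (r.1 * y) = r.1 * (x * y)
      rw [← mul_assoc, h, mul_assoc])
  have : Module.Finite (Subalgebra.center R Λᵐᵒᵖ) Λᵐᵒᵖ :=
    Module.Finite.of_restrictScalars_finite R _ _
  exact ⟨HomotopyCategory.isHomFinite_boundedAcyclic FGModuleCat.finite_hom,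
    HomotopyCategory.boundedAcyclic_fgModuleCat (R := Subalgebra.center R Λᵐᵒᵖ) hΛ⟩
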